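/- A turnstile stream for an $m\times n$ matrix is a finite sequence of updates $((i,j),c)$ with $(i,j)\in[m]\times[n]$ and $c\in\mathbb Z$; it defines the matrix $\mathbf A$ obtained from $\mathbf 0^{m\times n}$ by adding, for each update in turn, $c$ to the entry $(i,j)$. Words have $\ell$ bits, and the streams considered are those in which all update values, and all entries of the matrix at every moment, fit in a (signed) word, i.e. have absolute value less than $2^{\ell-1}$. A randomized single-pass algorithm using $S$ words keeps a memory of $S$ words of $\ell$ bits; it sets up the memory, replaces its content after each update as a function of the previous content, the update, the time and its random coins (which are not charged to the space), and finally outputs a real $m\times n$ matrix $\mathbf B$ determined by the final content and the coins. It solves $(\alpha,\beta,\gamma,k)$-low-rank approximation if for every such stream, with $\mathbf A$ the matrix defined by the stream, $$\Pr\Big[\operatorname{rank}(\mathbf B)\le k\ \text{ and }\ \|\mathbf A-\mathbf B\|_F\le(1+\alpha)\min_{\operatorname{rank}(\mathbf X)\le k}\|\mathbf A-\mathbf X\|_F+\gamma\Big]\ \ge\ 1-\beta .$$ Theorem. There is an absolute constant $c>0$ such that for every $C>0$ there is a $K>0$ with the following property. Let $m,n,k,\ell\in\mathbb N$, $\alpha>0$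 and $\gamma\le C(m+n)$, let $\frac{k}{20\alpha}\le\frac12\min\{m,n\}$ and $\ell\ge K\log_2(m+n)$. Then every randomized single-pass turnstile algorithm that solves $(\alpha,5/6,\gamma,k)$-low-rank approximation of $m\times n$ matrices (i.e. that succeeds with probability at least $1/6$ on every stream) uses at least $c\,(m+n)k/\alpha$ words of space. -/

import Mathlib

open scoped Matrix.Norms.Frobenius

/-- A turnstile update `((i, j), c)`: the integer `c` is added to the entry `(i, j)`. -/
abbrev TurnstileUpdate (m n : ℕ) : Type := (Fin m × Fin n) × ℤ

/-- The matrix obtained from the zero matrix by applying all the updates of a stream. -/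
def streamMatrix {m n : ℕ} (σ : List (TurnstileUpdate m n)) : Matrix (Fin m) (Fin n) ℤ :=
  (σ.map fun u => Matrix.single u.1.1 u.1.2 u.2).sum

/-- An integer that is representable in one (signed) word of `ℓ` bits: `|x| < 2 ^ (ℓ - 1)`. -/
def FitsWord (ℓ : ℕ) (x : ℤ) : Prop := 2 * |x| < 2 ^ ℓ

/-- A stream over words of `ℓ` bits: every update value, and every entry of the matrix at every
moment of the stream, fits in one word. -/
def IsWordStream {m n : ℕ} (ℓ : ℕ) (σ : List (TurnstileUpdate m n)) : Prop :=
  (∀ u ∈ σ, FitsWord ℓ u.2) ∧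
    ∀ p : List (TurnstileUpdate m n), p <+: σ → ∀ i j, FitsWord ℓ (streamMatrix p i j)

/-- A memory of `S` words of `ℓ` bits each. -/
abbrev Memory (S ℓ : ℕ) : Type := Fin S → Fin ℓ → Bool

/-- A randomized single-pass algorithm on turnstile streams for `m × n` matrices whose data
structure occupies `S` words of `ℓ` bits. The random coins are a point `ω` of the sample space `Ω`;
neither they nor the time `τ` are charged to the space, and having `τ` as an argument of `step`
lets the algorithm use fresh coins in every step. The answer depends only on the final content of
the memory and on the coins. -/
structure TurnstileAlgorithm (m n S ℓ : ℕ) (Ω : Type*) where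
  init : Ω → Memory S ℓ
  step : ℕ → Ω → Memory S ℓ → TurnstileUpdate m n → Memory S ℓ
  output : Ω → Memory S ℓ → Matrix (Fin m) (Fin n) ℝ

namespace TurnstileAlgorithm

variable {m n S ℓ : ℕ} {Ω : Type*}

/-- Content of the memory after processing a stream that starts at time `τ` with content `s`. -/
def runFrom (alg : TurnstileAlgorithm m n S ℓ Ω) (ω : Ω) :
    ℕ → Memory S ℓ → List (TurnstileUpdate m n) → Memory S ℓ
  | _, s, [] => s
  | τ, s, u :: σ => alg.runFrom ω (τ + 1) (alg.step τ ω s u) σ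

/-- The answer of the algorithm after one pass over the stream `σ` with coins `ω`. -/
def answer (alg : TurnstileAlgorithm m n S ℓ Ω) (ω : Ω) (σ : List (TurnstileUpdate m n)) :
    Matrix (Fin m) (Fin n) ℝ :=
  alg.output ω (alg.runFrom ω 0 (alg.init ω) σ)

end TurnstileAlgorithm

/-- The least Frobenius distance from `A` to a matrix of rank at most `k`. -/
noncomputable def lowRankError {m n : ℕ} (k : ℕ) (A : Matrix (Fin m) (Fin n) ℝ) : ℝ :=
  ⨅ X : {X : Matrix (Fin m) (Fin n) ℝ // X.rank ≤ k}, ‖A - X.1‖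

/-- `B` is a matrix of rank at most `k` that approximates `A` within the multiplicative error
`1 + α` and the additive error `γ` in the Frobenius norm. -/
def IsLowRankApprox {m n : ℕ} (α γ : ℝ) (k : ℕ) (A B : Matrix (Fin m) (Fin n) ℝ) : Prop :=
  B.rank ≤ k ∧ ‖A - B‖ ≤ (1 + α) * lowRankError k A + γ

/-- The algorithm solves `(α, β, γ, k)`-low-rank approximation in the turnstile model: on every
stream over words of `ℓ` bits, it succeeds with probability at least `1 - β` over its coins. -/
def SolvesLRA {m n S ℓ : ℕ} {Ω : Type*} [MeasurableSpace Ω] (μ : MeasureTheory.Measure Ω)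
    (alg : TurnstileAlgorithm m n S ℓ Ω) (α β γ : ℝ) (k : ℕ) : Prop :=
  ∀ σ : List (TurnstileUpdate m n), IsWordStream ℓ σ →
    MeasurableSet
        {ω | IsLowRankApprox α γ k ((streamMatrix σ).map (Int.cast : ℤ → ℝ)) (alg.answer ω σ)} ∧
      1 - β ≤ μ.real
        {ω | IsLowRankApprox α γ k ((streamMatrix σ).map (Int.cast : ℤ → ℝ)) (alg.answer ω σ)}

/-!
The data are `N * k * (n - k)` positions with `N ≈ 1 / α`: `N` blocks of `k` rows, in all columns
but the first `k`. At each position a number with `J ≈ ℓ` digits of size `q = O(1)` is written. If a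
constant fraction of these digits can be recovered from the memory, then the memory has
`Ω(N * k * n * ℓ)` bits, hence `Ω(n * k / α)` words.

To recover the level `j` of block `b`, continue the stream: delete all levels above `j` and add `P`
times the identity matrix in the rows of block `b` and the `k` free columns, with `P` huge. The rank
`k` of a good approximation is then spent on block `b`. The other blocks are lost, which costs
`‖Y‖`, and since `α * ‖Y‖ ^ 2` is small compared with one block, little error is left for block `b`:
most of its entries are correct up to a quarter of the unit of level `j`, and the levels below `j`
are smaller still. The lowest level starts above `γ`.

The query for level `j` depends on the levels above `j`, so this decoder is a predictor that guesses
the levels from the top down. For a fixed content of the memory, such a predictor guesses many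
digits correctly only for few data, since
`∑ x, q ^ (number of correct guesses) = (2 * q - 1) ^ (number of digits)`.
If `α` is bounded below, a single block of `k` full rows and no dominant matrix suffice.
-/

/-! ### Counting -/

section Counting

open Finset

variable {J : ℕ} {A E : Type*}

/-- Summing out the coordinates from the last to the first: the sum over coordinate `j` only
changes the factors `w i` with `i ≤ j`. -/
lemma sum_prod_eq_pow {R B : Type*} [CommSemiring R] [Fintype B] [Nonempty B] {c : R}
    {w : Fin J → (Fin J → B) → R} (hw : ∀ j x y, (∀ i ≥ j, x i = y i) → w j x = w j y)
    (hc : ∀ j x, ∑ b, w j (Function.update x j b) = c) : ∑ x, ∏ j, w j x = c ^ J := by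
  induction J with
  | zero => simp
  | succ J ih =>
    obtain ⟨b₀⟩ := ‹Nonempty B›
    have htail (x : Fin J → B) (b : B) (j : Fin J) :
        w j.succ (Fin.cons b x) = w j.succ (Fin.cons b₀ x) := by
      refine hw _ _ _ fun i hi => ?_
      obtain ⟨i, rfl⟩ := Fin.exists_succ_eq.2 (Fin.pos_iff_ne_zero.1 ((Fin.succ_pos j).trans_le hi))
      simp
    have hhead (x : Fin J → B) : ∑ b, w 0 (Fin.cons b x) = c := by
      simpa using hc 0 (Fin.cons b₀ x)
    have htailSum : ∑ x : Fin J → B, ∏ j : Fin J, w j.succ (Fin.cons b₀ x) = c ^ J := by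
      refine ih (fun j x y hxy => hw _ _ _ fun i hi => ?_) fun j x => ?_
      · obtain ⟨i, rfl⟩ :=
          Fin.exists_succ_eq.2 (Fin.pos_iff_ne_zero.1 ((Fin.succ_pos j).trans_le hi))
        simpa using hxy i (Fin.succ_le_succ_iff.1 hi)
      · simpa only [Fin.cons_update] using hc j.succ (Fin.cons b₀ x)
    calc ∑ x, ∏ j, w j x
        = ∑ x : Fin J → B, ∑ b, ∏ j, w j (Fin.cons b x) := by
          rw [← (Fin.consEquiv fun _ => B).sum_comp, Fintype.sum_prod_type_right]
          rfl
      _ = ∑ x : Fin J → B, c * ∏ j : Fin J, w j.succ (Fin.cons b₀ x) := by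
          simp only [Fin.prod_univ_succ, htail, ← sum_mul, hhead]
      _ = c ^ (J + 1) := by rw [← mul_sum, htailSum, pow_succ']

variable [Fintype A] [DecidableEq A] [Fintype E]

lemma sum_pow_card_filter_eq [DecidableEq E] {R : Type*} [CommRing R] (r : R) (g : E → A) :
    ∑ y : E → A, r ^ #{e | y e = g e} = (r + Fintype.card A - 1) ^ Fintype.card E := by
  have hsymbol (a : A) : ∑ b, (if b = a then r else 1) = r + Fintype.card A - 1 := by
    have hite (b : A) : (if b = a then r else 1) = (if b = a then r - 1 else 0) + 1 := by
      split_ifs <;> simp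
    simp only [hite, sum_add_distrib, sum_ite_eq', mem_univ, if_true, sum_const, card_univ,
      nsmul_one]
    ring
  calc ∑ y : E → A, r ^ #{e | y e = g e}
      = ∑ y : E → A, ∏ e, if y e = g e then r else 1 := by simp [prod_ite]
    _ = ∏ e, ∑ b, if b = g e then r else 1 := by
        rw [Fintype.prod_sum]
    _ = _ := by simp [hsymbol]

/-- The number of symbols in which two sequences of words over the alphabet `A` agree. -/
def agreement (x y : Fin J → E → A) : ℕ := ∑ j, #{e | x j e = y j e}

/-- A predictor `g` that guesses the words of a sequence `x` one after the other, from the last to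
the first, knowing all the words after the one it guesses. -/
def IsTopDown (g : (Fin J → E → A) → Fin J → E → A) : Prop :=
  ∀ x y j, (∀ i > j, x i = y i) → g x j = g y j

variable [DecidableEq E]

lemma IsTopDown.sum_pow_agreement [Nonempty A] {R : Type*} [CommRing R]
    {g : (Fin J → E → A) → Fin J → E → A} (hg : IsTopDown g) (r : R) :
    ∑ x, r ^ agreement x (g x) = (r + Fintype.card A - 1) ^ (Fintype.card E * J) := by
  simp only [agreement, ← prod_pow_eq_pow_sum, pow_mul]
  refine sum_prod_eq_pow (fun j x y hxy => ?_) fun j x => ?_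
  · rw [hxy j le_rfl, hg x y j fun i hi => hxy i (le_of_lt hi)]
  · have hguess (y : E → A) : g (Function.update x j y) j = g x j :=
      hg _ _ _ fun i hi => Function.update_of_ne (ne_of_gt hi) _ _
    simp only [hguess, Function.update_self, sum_pow_card_filter_eq]

lemma card_mul_rpow_le_sum_rpow {I : Type*} [Fintype I] {q d : ℝ} (hq : 1 ≤ q) {N : I → ℝ}
    (h : d * Fintype.card I ≤ ∑ i, N i) : Fintype.card I * q ^ d ≤ ∑ i, q ^ N i := by
  have hq0 : 0 < q := zero_lt_one.trans_le hq
  have htangent (i : I) : q ^ d * (1 + (N i - d) * Real.log q) ≤ q ^ N i := by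
    have hsplit : q ^ N i = q ^ d * q ^ (N i - d) := by rw [← Real.rpow_add hq0]; congr 1; ring
    rw [hsplit, Real.rpow_def_of_pos hq0 (N i - d)]
    gcongr
    linarith [Real.add_one_le_exp (Real.log q * (N i - d))]
  have hslope : 0 ≤ q ^ d * ((∑ i, N i - d * Fintype.card I) * Real.log q) :=
    mul_nonneg (by positivity) (mul_nonneg (sub_nonneg.2 h) (Real.log_nonneg hq))
  have hsum : ∑ i, q ^ d * (1 + (N i - d) * Real.log q)
      = Fintype.card I * q ^ d + q ^ d * ((∑ i, N i - d * Fintype.card I) * Real.log q) := by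
    simp only [← mul_sum, sum_add_distrib, ← sum_mul, sum_sub_distrib, sum_const, card_univ,
      nsmul_eq_mul, mul_one]
    ring
  linarith [sum_le_sum fun i (_ : i ∈ univ) => htangent i]

theorem rpow_le_card_mul_of_le_sum_agreement [Nonempty A] {M : Type*} [Fintype M]
    (enc : (Fin J → E → A) → M) {g : M → (Fin J → E → A) → Fin J → E → A}
    (hg : ∀ s, IsTopDown (g s)) {d : ℝ}
    (h : d * Fintype.card (Fin J → E → A) ≤ ∑ x, (agreement x (g (enc x) x) : ℝ)) :
    (Fintype.card A : ℝ) ^ d ≤ Fintype.card M * 2 ^ (Fintype.card E * J) := by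
  set q : ℝ := (Fintype.card A : ℝ)
  have hq : 1 ≤ q := Nat.one_le_cast.2 Fintype.card_pos
  have hcard : (Fintype.card (Fin J → E → A) : ℝ) = q ^ (Fintype.card E * J) := by
    simp [q, ← pow_mul]
  refine le_of_mul_le_mul_left ?_ (show 0 < q ^ (Fintype.card E * J) by positivity)
  calc q ^ (Fintype.card E * J) * q ^ d
      ≤ ∑ x, q ^ (agreement x (g (enc x) x) : ℝ) := hcard ▸ card_mul_rpow_le_sum_rpow hq h
    _ ≤ ∑ x, ∑ s, q ^ agreement x (g s x) := by
        simp only [Real.rpow_natCast]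
        exact sum_le_sum fun x _ => single_le_sum (f := fun s => q ^ agreement x (g s x))
          (fun s _ => by positivity) (mem_univ (enc x))
    _ = ∑ _s : M, (q + q - 1) ^ (Fintype.card E * J) := by
        rw [sum_comm]
        exact sum_congr rfl fun s _ => (hg s).sum_pow_agreement q
    _ ≤ ∑ _s : M, (q * 2) ^ (Fintype.card E * J) := by gcongr <;> linarith
    _ = q ^ (Fintype.card E * J) * (Fintype.card M * 2 ^ (Fintype.card E * J)) := by
        rw [sum_const, card_univ, nsmul_eq_mul, mul_pow]
        ring

lemma exists_mul_card_le_card_filter_mem {Ω I : Type*} [MeasurableSpace Ω] [Fintype I]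
    (μ : MeasureTheory.Measure Ω) [MeasureTheory.IsProbabilityMeasure μ] {s : I → Set Ω}
    [∀ ω i, Decidable (ω ∈ s i)] (hs : ∀ i, MeasurableSet (s i)) {p : ℝ}
    (hp : ∀ i, p ≤ μ.real (s i)) : ∃ ω, p * Fintype.card I ≤ #{i | ω ∈ s i} := by
  have hint (i : I) : MeasureTheory.Integrable ((s i).indicator (1 : Ω → ℝ)) μ :=
    (MeasureTheory.integrable_const 1).indicator (hs i)
  obtain ⟨ω, hω⟩ := MeasureTheory.exists_integral_le
    (MeasureTheory.integrable_finsetSum univ fun i _ => hint i)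
  refine ⟨ω, ?_⟩
  calc p * Fintype.card I = ∑ _i : I, p := by simp [mul_comm]
    _ ≤ ∑ i, μ.real (s i) := sum_le_sum fun i _ => hp i
    _ = ∫ ω, ∑ i, (s i).indicator 1 ω ∂μ := by
        simp only [MeasureTheory.integral_finsetSum _ fun i _ => hint i,
          MeasureTheory.integral_indicator_one (hs _)]
    _ ≤ ∑ i, (s i).indicator 1 ω := hω
    _ = #{i | ω ∈ s i} := by simp [Set.indicator_apply]

end Counting

/-! ### Streams that write matrices -/

section EntryMatrix

variable {E R ι κ : Type*}

/-- The matrix whose entry at the position `φ e` is `w e` for every `e`, and whose other entries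
are zero. -/
noncomputable def entryMatrix [Zero R] (φ : E ↪ ι × κ) (w : E → R) : Matrix ι κ R :=
  Matrix.of fun i j => Function.extend φ w 0 (i, j)

lemma entryMatrix_apply_self [Zero R] (φ : E ↪ ι × κ) (w : E → R) (e : E) :
    entryMatrix φ w (φ e).1 (φ e).2 = w e :=
  φ.injective.extend_apply w 0 e

lemma entryMatrix_apply_of_forall_ne [Zero R] {φ : E ↪ ι × κ} (w : E → R) {i : ι} {j : κ}
    (h : ∀ e, φ e ≠ (i, j)) : entryMatrix φ w i j = 0 :=
  Function.extend_apply' w (0 : ι × κ → R) (i, j) (not_exists.2 h)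

lemma forall_entryMatrix [Zero R] {φ : E ↪ ι × κ} {w : E → R} {p : R → Prop} (h0 : p 0)
    (hw : ∀ e, p (w e)) (i : ι) (j : κ) : p (entryMatrix φ w i j) := by
  by_cases h : ∃ e, φ e = (i, j)
  · obtain ⟨e, he⟩ := h
    simpa only [← entryMatrix_apply_self φ w e, he] using hw e
  · rwa [entryMatrix_apply_of_forall_ne w (not_exists.1 h)]

lemma entryMatrix_add [AddZeroClass R] (φ : E ↪ ι × κ) (v w : E → R) :
    entryMatrix φ (v + w) = entryMatrix φ v + entryMatrix φ w := by
  have h := Function.extend_add φ v w (0 : ι × κ → R) 0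
  rw [add_zero] at h
  ext i j
  exact congrFun h (i, j)

lemma entryMatrix_transpose [Zero R] (φ : E ↪ ι × κ) (w : E → R) :
    (entryMatrix φ w).transpose
      = entryMatrix (φ.trans (Equiv.prodComm ι κ).toEmbedding) w := by
  ext j i
  by_cases h : ∃ e, φ e = (i, j)
  · obtain ⟨e, he⟩ := h
    have hl := entryMatrix_apply_self φ w e
    have hr := entryMatrix_apply_self (φ.trans (Equiv.prodComm ι κ).toEmbedding) w e
    simp only [Function.Embedding.trans_apply, Equiv.coe_toEmbedding, Equiv.prodComm_apply, he,
      Prod.swap_prod_mk] at hl hr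
    rw [Matrix.transpose_apply, hl, hr]
  · rw [Matrix.transpose_apply, entryMatrix_apply_of_forall_ne w (not_exists.1 h),
      entryMatrix_apply_of_forall_ne w fun e he => h ⟨e, Prod.swap_injective he⟩]

lemma entryMatrix_map [Zero R] {R' : Type*} [Zero R'] (φ : E ↪ ι × κ) (w : E → R) {f : R → R'}
    (hf : f 0 = 0) : (entryMatrix φ w).map f = entryMatrix φ (f ∘ w) := by
  ext i j
  by_cases h : ∃ e, φ e = (i, j)
  · obtain ⟨e, he⟩ := h
    have hl := entryMatrix_apply_self φ w e
    have hr := entryMatrix_apply_self φ (f ∘ w) e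
    rw [he] at hl hr
    rw [Matrix.map_apply, hl, hr, Function.comp_apply]
  · rw [Matrix.map_apply, entryMatrix_apply_of_forall_ne w (not_exists.1 h), hf,
      entryMatrix_apply_of_forall_ne _ (not_exists.1 h)]

end EntryMatrix

section Streams

variable {m n : ℕ}

lemma streamMatrix_append (σ τ : List (TurnstileUpdate m n)) :
    streamMatrix (σ ++ τ) = streamMatrix σ + streamMatrix τ := by
  simp [streamMatrix]

lemma streamMatrix_map_apply (M : Matrix (Fin m) (Fin n) ℤ) {L : List (Fin m × Fin n)}
    (hL : L.Nodup) (i : Fin m) (j : Fin n) :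
    streamMatrix (L.map fun p => (p, M p.1 p.2)) i j = if (i, j) ∈ L then M i j else 0 := by
  induction L with
  | nil => simp [streamMatrix]
  | cons p L ih =>
    obtain ⟨hp, hL⟩ := List.nodup_cons.1 hL
    have hcons : streamMatrix ((p :: L).map fun p => (p, M p.1 p.2)) i j
        = Matrix.single p.1 p.2 (M p.1 p.2) i j
          + streamMatrix (L.map fun p => (p, M p.1 p.2)) i j := by
      simp [streamMatrix]
    rw [hcons, ih hL]
    obtain rfl | hne := eq_or_ne p (i, j)
    · simp [hp]
    · rw [Matrix.single_apply_of_ne _ _ _ _ _ fun h => hne (Prod.ext h.1 h.2), zero_add]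
      simp only [List.mem_cons, hne.symm, false_or]

/-- A stream that writes the matrix `M`, with one update for each entry. -/
noncomputable def matrixStream (M : Matrix (Fin m) (Fin n) ℤ) : List (TurnstileUpdate m n) :=
  (Finset.univ : Finset (Fin m × Fin n)).toList.map fun p => (p, M p.1 p.2)

lemma length_matrixStream (M : Matrix (Fin m) (Fin n) ℤ) : (matrixStream M).length = m * n := by
  simp [matrixStream]

lemma streamMatrix_matrixStream (M : Matrix (Fin m) (Fin n) ℤ) :
    streamMatrix (matrixStream M) = M := by
  ext i j
  rw [matrixStream, streamMatrix_map_apply M (Finset.nodup_toList _)]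
  simp

lemma streamMatrix_eq_or_eq_zero_of_prefix (M : Matrix (Fin m) (Fin n) ℤ)
    {p : List (TurnstileUpdate m n)} (hp : p <+: matrixStream M) (i : Fin m) (j : Fin n) :
    streamMatrix p i j = M i j ∨ streamMatrix p i j = 0 := by
  rw [matrixStream, List.prefix_iff_eq_take, ← List.map_take] at hp
  rw [hp, streamMatrix_map_apply M ((Finset.nodup_toList _).sublist (List.take_sublist _ _))]
  exact ite_eq_or_eq _ _ _

lemma fitsWord_zero (ℓ : ℕ) : FitsWord ℓ 0 := by simp [FitsWord]

lemma isWordStream_matrixStream_append {ℓ : ℕ} {M N : Matrix (Fin m) (Fin n) ℤ}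
    (hM : ∀ i j, FitsWord ℓ (M i j)) (hN : ∀ i j, FitsWord ℓ (N i j))
    (hMN : ∀ i j, FitsWord ℓ ((M + N) i j)) :
    IsWordStream ℓ (matrixStream M ++ matrixStream N) := by
  refine ⟨fun u hu => ?_, fun p hp i j => ?_⟩
  · rcases List.mem_append.1 hu with hu | hu
    · obtain ⟨p, -, rfl⟩ := List.mem_map.1 hu
      exact hM p.1 p.2
    · obtain ⟨p, -, rfl⟩ := List.mem_map.1 hu
      exact hN p.1 p.2
  · rcases List.prefix_or_prefix_of_prefix hp (List.prefix_append _ _) with hp | ⟨t, rfl⟩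
    · rcases streamMatrix_eq_or_eq_zero_of_prefix M hp i j with h | h <;> rw [h]
      · exact hM i j
      · exact fitsWord_zero ℓ
    · have ht : t <+: matrixStream N := (List.prefix_append_right_inj _).1 hp
      rw [streamMatrix_append, Matrix.add_apply, streamMatrix_matrixStream]
      rcases streamMatrix_eq_or_eq_zero_of_prefix N ht i j with h | h <;> rw [h]
      · exact hMN i j
      · simpa using hM i j

lemma TurnstileAlgorithm.runFrom_append {S ℓ : ℕ} {Ω : Type*} (alg : TurnstileAlgorithm m n S ℓ Ω)
    (ω : Ω) (σ ρ : List (TurnstileUpdate m n)) (τ : ℕ) (s : Memory S ℓ) :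
    alg.runFrom ω τ s (σ ++ ρ) = alg.runFrom ω (τ + σ.length) (alg.runFrom ω τ s σ) ρ := by
  induction σ generalizing τ s with
  | nil => simp [runFrom]
  | cons u σ ih => simp only [List.cons_append, runFrom, List.length_cons, ih, add_right_comm,
      add_assoc]

end Streams

/-! ### Numbers with several levels of digits -/

section Digits

/-- The digit `a < q` for which `U * a` is nearest to `y`, where a digit with `2 * |y - U * a| < U`
is assumed to exist. -/
noncomputable def nearestDigit (q : ℕ) [NeZero q] (U y : ℝ) : Fin q :=
  Fin.ofNat q (round (y / U)).toNat

lemma nearestDigit_eq {q : ℕ} [NeZero q] {U y : ℝ} {a : Fin q} (h : 2 * |y - U * (a : ℕ)| < U) :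
    nearestDigit q U y = a := by
  have hU : 0 < U := lt_of_le_of_lt (by positivity) h
  have hround : round (y / U) = (a : ℕ) := by
    obtain ⟨hlo, hhi⟩ := abs_lt.1 (show |y - U * (a : ℕ)| < U / 2 by linarith)
    rw [round_eq_iff, Set.mem_Ico, Int.cast_natCast, le_div_iff₀ hU, div_lt_iff₀ hU]
    constructor <;> linarith
  simp [nearestDigit, hround]

variable {E : Type*} {q J : ℕ}

/-- The number with digits `x i e` at the levels `i ∈ s`, where level `i` has weight
`D * (8 * q) ^ i`. The base `8 * q` is larger than the number `q` of digits to leave room for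
errors: all the levels below a given one together weigh at most a quarter of its weight. -/
def digitSum (D : ℕ) (s : Finset (Fin J)) (x : Fin J → E → Fin q) (e : E) : ℤ :=
  ∑ i ∈ s, (D * (8 * q) ^ (i : ℕ) : ℤ) * (x i e : ℕ)

lemma digitSum_nonneg (D : ℕ) (s : Finset (Fin J)) (x : Fin J → E → Fin q) (e : E) :
    0 ≤ digitSum D s x e :=
  Finset.sum_nonneg fun i _ => by positivity

lemma digitSum_congr (D : ℕ) {s : Finset (Fin J)} {x y : Fin J → E → Fin q}
    (h : ∀ i ∈ s, x i = y i) : digitSum D s x = digitSum D s y := by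
  funext e
  exact Finset.sum_congr rfl fun i hi => by rw [h i hi]

lemma digitSum_Iic (D : ℕ) (x : Fin J → E → Fin q) (j : Fin J) (e : E) :
    digitSum D (Finset.Iic j) x e
      = digitSum D (Finset.Iio j) x e + (D * (8 * q) ^ (j : ℕ) : ℤ) * (x j e : ℕ) := by
  simp only [digitSum]
  rw [← Finset.Iio_insert, Finset.sum_insert (by simp), add_comm]

lemma digitSum_Iic_add_Ioi (D : ℕ) (x : Fin J → E → Fin q) (j : Fin J) :
    digitSum D (Finset.Iic j) x + digitSum D (Finset.Ioi j) x = digitSum D Finset.univ x := by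
  have hcompl : (Finset.Iic j)ᶜ = Finset.Ioi j := by ext; simp
  funext e
  simp only [Pi.add_apply, digitSum]
  rw [← hcompl, Finset.sum_add_sum_compl]

variable [NeZero q]

lemma four_mul_geom_sum_le (q j : ℕ) [NeZero q] :
    4 * q * ∑ i ∈ Finset.range j, (8 * q : ℤ) ^ i ≤ (8 * q) ^ j := by
  have hq : (1 : ℤ) ≤ q := by exact_mod_cast NeZero.one_le (n := q)
  have hsum : 0 ≤ ∑ i ∈ Finset.range j, (8 * q : ℤ) ^ i := by positivity
  nlinarith [mul_geom_sum (8 * q : ℤ) j]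

lemma four_mul_digitSum_le (D : ℕ) {s : Finset (Fin J)} {j : ℕ} (hs : ∀ i ∈ s, (i : ℕ) < j)
    (x : Fin J → E → Fin q) (e : E) : 4 * digitSum D s x e ≤ D * (8 * q) ^ j := by
  have hlevel (i : Fin J) : (D * (8 * q) ^ (i : ℕ) : ℤ) * (x i e : ℕ)
      ≤ D * (8 * q) ^ (i : ℕ) * q := by
    gcongr
    exact (x i e).2.le
  calc 4 * digitSum D s x e
      ≤ 4 * ∑ i ∈ s, (D * (8 * q) ^ (i : ℕ) * q : ℤ) := by
        gcongr
        exact Finset.sum_le_sum fun i _ => hlevel i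
    _ = 4 * ∑ i ∈ s.map Fin.valEmbedding, (D * (8 * q) ^ i * q : ℤ) := by
        rw [Finset.sum_map]
        rfl
    _ ≤ 4 * ∑ i ∈ Finset.range j, (D * (8 * q) ^ i * q : ℤ) := by
        gcongr
        simpa [Finset.subset_iff] using hs
    _ = D * (4 * q * ∑ i ∈ Finset.range j, (8 * q : ℤ) ^ i) := by
        rw [← Finset.sum_mul, ← Finset.mul_sum]
        ring
    _ ≤ D * (8 * q) ^ j := by
        gcongr
        exact four_mul_geom_sum_le q j

lemma four_mul_digitSum_Iio_le (D : ℕ) (x : Fin J → E → Fin q) (j : Fin J) (e : E) :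
    4 * digitSum D (Finset.Iio j) x e ≤ D * (8 * q) ^ (j : ℕ) :=
  four_mul_digitSum_le D (fun _ hi => Fin.lt_def.1 (Finset.mem_Iio.1 hi)) x e

lemma digitSum_Iic_le (D : ℕ) (x : Fin J → E → Fin q) (j : Fin J) (e : E) :
    digitSum D (Finset.Iic j) x e ≤ q * (D * (8 * q) ^ (j : ℕ) : ℕ) := by
  have hlower := four_mul_digitSum_Iio_le D x j e
  have hdigit : ((x j e : ℕ) : ℤ) + 1 ≤ q := by exact_mod_cast (x j e).2
  have hweight : (0 : ℤ) ≤ D * (8 * q) ^ (j : ℕ) := by positivity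
  rw [digitSum_Iic]
  push_cast
  nlinarith

lemma four_mul_abs_digitSum_Iic_sub_le (D : ℕ) (x : Fin J → E → Fin q) (j : Fin J) (e : E) :
    4 * |(digitSum D (Finset.Iic j) x e : ℝ) - (D * (8 * q) ^ (j : ℕ) : ℕ) * (x j e : ℕ)|
      ≤ (D * (8 * q) ^ (j : ℕ) : ℕ) := by
  have hlower := four_mul_digitSum_Iio_le D x j e
  have hnonneg := digitSum_nonneg D (Finset.Iio j) x e
  rw [digitSum_Iic]
  push_cast
  rw [add_sub_cancel_right, abs_of_nonneg (by exact_mod_cast hnonneg)]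
  exact_mod_cast hlower

end Digits

/-! ### Predicting the digits from the memory of a low-rank approximation algorithm -/

section Reduction

variable {m n q D J : ℕ} {E ι F : Type*}

/-- Data `v` that consists of blocks `v (b, ·)` of numbers in `[0, q * U]` is written at the
positions `φ`. Block decodability says that, once the matrix `G b` has been added, every solution of
the low-rank approximation problem reveals a fraction `ρ` of the numbers of the block `b`, up to an
error of a quarter of the unit `U`. -/
def BlockDecodable [Fintype F] (ρ α γ : ℝ) (k q U : ℕ) (φ : ι × F ↪ Fin m × Fin n)
    (G : ι → Matrix (Fin m) (Fin n) ℤ) : Prop :=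
  ∀ (b : ι) (v : ι × F → ℤ), (∀ e, 0 ≤ v e ∧ v e ≤ q * U) → ∀ B : Matrix (Fin m) (Fin n) ℝ,
    IsLowRankApprox α γ k ((entryMatrix φ v + G b).map (Int.cast : ℤ → ℝ)) B →
      ρ * Fintype.card F
        ≤ (Finset.univ.filter fun f => 4 * |B (φ (b, f)).1 (φ (b, f)).2 - v (b, f)| < U).card

/-- The stream that writes all the levels of the digits `x` at the positions `φ`. -/
noncomputable def dataStream (D : ℕ) (φ : E ↪ Fin m × Fin n) (x : Fin J → E → Fin q) :
    List (TurnstileUpdate m n) :=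
  matrixStream (entryMatrix φ (digitSum D Finset.univ x))

/-- The stream that, following `dataStream D φ x`, deletes the levels of `x` above `j` and adds the
matrix `H`. -/
noncomputable def queryStream (D : ℕ) (φ : E ↪ Fin m × Fin n) (H : Matrix (Fin m) (Fin n) ℤ)
    (x : Fin J → E → Fin q) (j : Fin J) : List (TurnstileUpdate m n) :=
  matrixStream (H - entryMatrix φ (digitSum D (Finset.Ioi j) x))

lemma entryMatrix_digitSum_univ_add_sub (D : ℕ) (φ : E ↪ Fin m × Fin n)
    (H : Matrix (Fin m) (Fin n) ℤ) (x : Fin J → E → Fin q) (j : Fin J) :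
    entryMatrix φ (digitSum D Finset.univ x) + (H - entryMatrix φ (digitSum D (Finset.Ioi j) x))
      = entryMatrix φ (digitSum D (Finset.Iic j) x) + H := by
  rw [← digitSum_Iic_add_Ioi D x j, entryMatrix_add]
  abel

lemma streamMatrix_dataStream_append_queryStream (D : ℕ) (φ : E ↪ Fin m × Fin n)
    (H : Matrix (Fin m) (Fin n) ℤ) (x : Fin J → E → Fin q) (j : Fin J) :
    streamMatrix (dataStream D φ x ++ queryStream D φ H x j)
      = entryMatrix φ (digitSum D (Finset.Iic j) x) + H := by
  rw [streamMatrix_append, dataStream, queryStream, streamMatrix_matrixStream,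
    streamMatrix_matrixStream, entryMatrix_digitSum_univ_add_sub]

lemma queryStream_congr (D : ℕ) (φ : E ↪ Fin m × Fin n) (H : Matrix (Fin m) (Fin n) ℤ)
    {x y : Fin J → E → Fin q} {j : Fin J} (h : ∀ i > j, x i = y i) :
    queryStream D φ H x j = queryStream D φ H y j := by
  rw [queryStream, queryStream, digitSum_congr D fun i hi => h i (Finset.mem_Ioi.1 hi)]

lemma isWordStream_dataStream_append_queryStream [NeZero q] {ℓ : ℕ}
    (hJ : D * (8 * q) ^ J ≤ 2 ^ ℓ) (φ : E ↪ Fin m × Fin n) {H : Matrix (Fin m) (Fin n) ℤ}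
    (hH : ∀ i j, 4 * |H i j| < 2 ^ ℓ) (x : Fin J → E → Fin q) (j : Fin J) :
    IsWordStream ℓ (dataStream D φ x ++ queryStream D φ H x j) := by
  have hdata (s : Finset (Fin J)) (i : Fin m) (i' : Fin n) :
      0 ≤ entryMatrix φ (digitSum D s x) i i' ∧
        4 * entryMatrix φ (digitSum D s x) i i' ≤ 2 ^ ℓ :=
    forall_entryMatrix (p := fun z => 0 ≤ z ∧ 4 * z ≤ 2 ^ ℓ) (by simp)
      (fun e => ⟨digitSum_nonneg D s x e,
        (four_mul_digitSum_le D (fun i _ => i.2) x e).trans (by exact_mod_cast hJ)⟩) i i'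
  refine isWordStream_matrixStream_append (fun i i' => ?_) (fun i i' => ?_) fun i i' => ?_
  · obtain ⟨hnonneg, hle⟩ := hdata Finset.univ i i'
    rw [FitsWord, abs_of_nonneg hnonneg]
    linarith [show (0 : ℤ) < 2 ^ ℓ by positivity]
  · obtain ⟨hnonneg, hle⟩ := hdata (Finset.Ioi j) i i'
    have habs := abs_sub (H i i') (entryMatrix φ (digitSum D (Finset.Ioi j) x) i i')
    rw [abs_of_nonneg hnonneg] at habs
    rw [FitsWord, Matrix.sub_apply]
    linarith [hH i i']
  · obtain ⟨hnonneg, hle⟩ := hdata (Finset.Iic j) i i'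
    have habs := abs_add_le (entryMatrix φ (digitSum D (Finset.Iic j) x) i i') (H i i')
    rw [abs_of_nonneg hnonneg] at habs
    rw [entryMatrix_digitSum_univ_add_sub, FitsWord, Matrix.add_apply]
    linarith [hH i i']

namespace TurnstileAlgorithm

variable {S ℓ : ℕ} {Ω : Type*} [NeZero q]

/-- The prediction of level `j` of the digits `x` from the content `s` of the memory after
`dataStream D φ x`: the query of the block of `e`, which depends only on the levels above `j`, is
processed, and the answer at the position of `e` is rounded to a digit of level `j`. -/
noncomputable def predict (alg : TurnstileAlgorithm m n S ℓ Ω) (ω : Ω) (D : ℕ)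
    (φ : ι × F ↪ Fin m × Fin n) (G : ι → Matrix (Fin m) (Fin n) ℤ) (s : Memory S ℓ)
    (x : Fin J → ι × F → Fin q) (j : Fin J) (e : ι × F) : Fin q :=
  nearestDigit q (D * (8 * q) ^ (j : ℕ) : ℕ)
    (alg.output ω (alg.runFrom ω (m * n) s (queryStream D φ (G e.1) x j)) (φ e).1 (φ e).2)

lemma isTopDown_predict (alg : TurnstileAlgorithm m n S ℓ Ω) (ω : Ω) (D : ℕ)
    (φ : ι × F ↪ Fin m × Fin n) (G : ι → Matrix (Fin m) (Fin n) ℤ) (s : Memory S ℓ) :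
    IsTopDown (alg.predict (J := J) (q := q) ω D φ G s) := by
  intro x y j hxy
  funext e
  rw [predict, predict, queryStream_congr D φ (G e.1) hxy]

/-- The memory after the data has been processed. -/
noncomputable def encode (alg : TurnstileAlgorithm m n S ℓ Ω) (ω : Ω) (D : ℕ)
    (φ : E ↪ Fin m × Fin n) (x : Fin J → E → Fin q) : Memory S ℓ :=
  alg.runFrom ω 0 (alg.init ω) (dataStream D φ x)

lemma le_card_filter_eq_predict [Fintype F] {ρ α γ : ℝ} {k : ℕ} {φ : ι × F ↪ Fin m × Fin n}
    {G : ι → Matrix (Fin m) (Fin n) ℤ} {alg : TurnstileAlgorithm m n S ℓ Ω} {ω : Ω}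
    {x : Fin J → ι × F → Fin q} {j : Fin J} {b : ι}
    (hdec : BlockDecodable ρ α γ k q (D * (8 * q) ^ (j : ℕ)) φ G)
    (h : IsLowRankApprox α γ k
      ((entryMatrix φ (digitSum D (Finset.Iic j) x) + G b).map (Int.cast : ℤ → ℝ))
      (alg.answer ω (dataStream D φ x ++ queryStream D φ (G b) x j))) :
    ρ * Fintype.card F ≤ (Finset.univ.filter fun f =>
      x j (b, f) = alg.predict ω D φ G (alg.encode ω D φ x) x j (b, f)).card := by
  refine (hdec b _ (fun e => ⟨digitSum_nonneg D _ x e, digitSum_Iic_le D x j e⟩) _ h).trans ?_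
  have hanswer : alg.answer ω (dataStream D φ x ++ queryStream D φ (G b) x j)
      = alg.output ω (alg.runFrom ω (m * n) (alg.encode ω D φ x) (queryStream D φ (G b) x j)) := by
    rw [answer, runFrom_append, encode, dataStream, length_matrixStream, zero_add]
  gcongr with f
  intro hf
  rw [hanswer] at hf
  refine (nearestDigit_eq ?_).symm
  linarith [four_mul_abs_digitSum_Iic_sub_le D x j (b, f), abs_sub_le
    (alg.output ω (alg.runFrom ω (m * n) (alg.encode ω D φ x) (queryStream D φ (G b) x j))
      (φ (b, f)).1 (φ (b, f)).2) (digitSum D (Finset.Iic j) x (b, f))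
    ((D * (8 * q) ^ (j : ℕ) : ℕ) * (x j (b, f) : ℕ))]

end TurnstileAlgorithm

lemma card_filter_mul_le_sum_agreement {X A : Type*} [Fintype X] [Fintype ι] [Fintype F]
    [DecidableEq A] {y z : X → Fin J → ι × F → A} {p : X × Fin J × ι → Prop} [DecidablePred p]
    {c : ℝ} (h : ∀ x j b, p (x, j, b) →
      c ≤ (Finset.univ.filter fun f => y x j (b, f) = z x j (b, f)).card) :
    (Finset.univ.filter p).card * c ≤ ∑ x, (agreement (y x) (z x) : ℝ) := by
  calc ((Finset.univ.filter p).card * c : ℝ)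
      = ∑ x, ∑ j, ∑ b, if p (x, j, b) then c else 0 := by
        rw [← nsmul_eq_mul, ← Finset.sum_const, Finset.sum_filter, Fintype.sum_prod_type]
        simp only [Fintype.sum_prod_type]
    _ ≤ ∑ x, ∑ j, ∑ b,
          ((Finset.univ.filter fun f => y x j (b, f) = z x j (b, f)).card : ℝ) := by
        gcongr with x _ j _ b _
        split_ifs with hp
        · exact h x j b hp
        · positivity
    _ = ∑ x, (agreement (y x) (z x) : ℝ) := by
        simp only [agreement, Finset.card_filter, Fintype.sum_prod_type, Nat.cast_sum]

theorem rpow_le_of_solvesLRA [Fintype ι] [Fintype F] [NeZero q] {S ℓ k : ℕ} {ρ α β γ : ℝ}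
    (hρ : 0 ≤ ρ) {φ : ι × F ↪ Fin m × Fin n} {G : ι → Matrix (Fin m) (Fin n) ℤ}
    (hdec : ∀ j < J, BlockDecodable ρ α γ k q (D * (8 * q) ^ j) φ G)
    (hJ : D * (8 * q) ^ J ≤ 2 ^ ℓ) (hG : ∀ b i j, 4 * |G b i j| < 2 ^ ℓ)
    {Ω : Type*} [MeasurableSpace Ω] {μ : MeasureTheory.Measure Ω}
    [MeasureTheory.IsProbabilityMeasure μ] {alg : TurnstileAlgorithm m n S ℓ Ω}
    (halg : SolvesLRA μ alg α β γ k) :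
    (q : ℝ) ^ ((1 - β) * ρ * (Fintype.card ι * Fintype.card F * J))
      ≤ 2 ^ (S * ℓ) * 2 ^ (Fintype.card ι * Fintype.card F * J) := by
  classical
  let good (p : (Fin J → ι × F → Fin q) × Fin J × ι) : Set Ω :=
    {ω | IsLowRankApprox α γ k
      ((entryMatrix φ (digitSum D (Finset.Iic p.2.1) p.1) + G p.2.2).map (Int.cast : ℤ → ℝ))
      (alg.answer ω (dataStream D φ p.1 ++ queryStream D φ (G p.2.2) p.1 p.2.1))}
  have hgood p : MeasurableSet (good p) ∧ 1 - β ≤ μ.real (good p) := by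
    simpa only [streamMatrix_dataStream_append_queryStream] using
      halg _ (isWordStream_dataStream_append_queryStream hJ φ (hG p.2.2) p.1 p.2.1)
  obtain ⟨ω, hω⟩ := exists_mul_card_le_card_filter_mem μ (fun p => (hgood p).1) fun p => (hgood p).2
  have hagree : (1 - β) * ρ * (Fintype.card ι * Fintype.card F * J)
        * Fintype.card (Fin J → ι × F → Fin q)
      ≤ ∑ x : Fin J → ι × F → Fin q,
          (agreement x (alg.predict ω D φ G (alg.encode ω D φ x) x) : ℝ) :=
    calc _ = (1 - β) * Fintype.card ((Fin J → ι × F → Fin q) × Fin J × ι)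
            * (ρ * Fintype.card F) := by
          simp only [Fintype.card_prod, Fintype.card_fin]
          push_cast
          ring
      _ ≤ _ := mul_le_mul_of_nonneg_right hω (by positivity)
      _ ≤ _ := card_filter_mul_le_sum_agreement fun x j b hx =>
          TurnstileAlgorithm.le_card_filter_eq_predict (hdec j j.2) hx
  have hmemory : Fintype.card (Memory S ℓ) = 2 ^ (S * ℓ) := by
    simp [← pow_mul, mul_comm]
  have hcount := rpow_le_card_mul_of_le_sum_agreement (alg.encode ω D φ)
    (fun s => alg.isTopDown_predict ω D φ G s) hagree
  rwa [Fintype.card_fin, hmemory, Fintype.card_prod, Nat.cast_pow, Nat.cast_ofNat] at hcount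

end Reduction

/-! ### The Frobenius norm and the low-rank error -/

section Frobenius

variable {ι κ ι' κ' : Type*} [Fintype ι] [Fintype κ] [Fintype ι'] [Fintype κ']

lemma frobenius_norm_sq (Z : Matrix ι κ ℝ) : ‖Z‖ ^ 2 = ∑ i, ∑ j, Z i j ^ 2 := by
  rw [Matrix.frobenius_norm_def, ← Real.sqrt_eq_rpow, Real.sq_sqrt (by positivity)]
  simp

lemma frobenius_norm_sq_fromBlocks (A : Matrix ι κ ℝ) (B : Matrix ι κ' ℝ) (C : Matrix ι' κ ℝ)
    (D : Matrix ι' κ' ℝ) :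
    ‖Matrix.fromBlocks A B C D‖ ^ 2 = ‖A‖ ^ 2 + ‖B‖ ^ 2 + (‖C‖ ^ 2 + ‖D‖ ^ 2) := by
  simp only [frobenius_norm_sq, Fintype.sum_sum_type, Matrix.fromBlocks_apply₁₁,
    Matrix.fromBlocks_apply₁₂, Matrix.fromBlocks_apply₂₁, Matrix.fromBlocks_apply₂₂,
    Finset.sum_add_distrib]
  ring

lemma frobenius_norm_submatrix_le (Z : Matrix ι κ ℝ) {r : ι' → ι} {c : κ' → κ}
    (hr : Function.Injective r) (hc : Function.Injective c) : ‖Z.submatrix r c‖ ≤ ‖Z‖ := by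
  classical
  refine le_of_sq_le_sq ?_ (norm_nonneg Z)
  calc ‖Z.submatrix r c‖ ^ 2 = ∑ p : ι' × κ', Z (r p.1) (c p.2) ^ 2 := by
        rw [frobenius_norm_sq, Fintype.sum_prod_type]
        rfl
    _ = ∑ p ∈ Finset.univ.map ⟨Prod.map r c, hr.prodMap hc⟩, Z p.1 p.2 ^ 2 := by
        rw [Finset.sum_map]
        rfl
    _ ≤ ∑ p : ι × κ, Z p.1 p.2 ^ 2 :=
        Finset.sum_le_univ_sum_of_nonneg fun p => sq_nonneg _
    _ = ‖Z‖ ^ 2 := by rw [frobenius_norm_sq, Fintype.sum_prod_type]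

lemma frobenius_norm_submatrix_equiv (Z : Matrix ι κ ℝ) (r : ι' ≃ ι) (c : κ' ≃ κ) :
    ‖Z.submatrix r c‖ = ‖Z‖ := by
  refine le_antisymm (frobenius_norm_submatrix_le Z r.injective c.injective) ?_
  simpa using frobenius_norm_submatrix_le (Z.submatrix r c) r.symm.injective c.symm.injective

lemma abs_apply_le_frobenius_norm (Z : Matrix ι κ ℝ) (i : ι) (j : κ) : |Z i j| ≤ ‖Z‖ := by
  have h := frobenius_norm_submatrix_le Z (r := fun _ : Unit => i) (c := fun _ : Unit => j)
    (Function.injective_of_subsingleton _) (Function.injective_of_subsingleton _)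
  refine le_trans (abs_le_of_sq_le_sq ?_ (norm_nonneg _)) h
  simp [frobenius_norm_sq]

lemma frobenius_norm_sq_entryMatrix {E : Type*} [Fintype E] (φ : E ↪ ι × κ) (w : E → ℝ) :
    ‖entryMatrix φ w‖ ^ 2 = ∑ e, w e ^ 2 := by
  rw [frobenius_norm_sq, ← Fintype.sum_prod_type' fun i j => entryMatrix φ w i j ^ 2]
  refine (Fintype.sum_of_injective φ φ.injective _ _ (fun p hp => ?_) fun e => ?_).symm
  · rw [entryMatrix_apply_of_forall_ne w fun e he => hp ⟨e, he⟩, zero_pow two_ne_zero]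
  · rw [entryMatrix_apply_self]

lemma frobenius_norm_sq_entryMatrix_le {E : Type*} [Fintype E] (φ : E ↪ ι × κ) {w : E → ℝ}
    {b : ℝ} (hw : ∀ e, |w e| ≤ b) : ‖entryMatrix φ w‖ ^ 2 ≤ Fintype.card E * b ^ 2 := by
  rw [frobenius_norm_sq_entryMatrix]
  refine (Finset.sum_le_card_nsmul _ _ _ fun e _ => sq_le_sq.2 ((hw e).trans (le_abs_self b))).trans
    ?_
  rw [nsmul_eq_mul, Finset.card_univ]

variable {m n k : ℕ} {α γ : ℝ}

lemma lowRankError_le {A X : Matrix (Fin m) (Fin n) ℝ} (hX : X.rank ≤ k) :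
    lowRankError k A ≤ ‖A - X‖ :=
  ciInf_le (f := fun X : {X : Matrix (Fin m) (Fin n) ℝ // X.rank ≤ k} => ‖A - X.1‖)
    ⟨0, by rintro _ ⟨X, rfl⟩; exact norm_nonneg _⟩ ⟨X, hX⟩

lemma lowRankError_transpose_le (k : ℕ) (A : Matrix (Fin m) (Fin n) ℝ) :
    lowRankError k A.transpose ≤ lowRankError k A := by
  have : Nonempty {X : Matrix (Fin m) (Fin n) ℝ // X.rank ≤ k} := ⟨⟨0, by simp⟩⟩
  refine le_ciInf fun X => (lowRankError_le (X := X.1.transpose) ?_).trans_eq ?_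
  · exact (Matrix.rank_transpose X.1).trans_le X.2
  · rw [← Matrix.transpose_sub, Matrix.frobenius_norm_transpose]

lemma lowRankError_transpose (k : ℕ) (A : Matrix (Fin m) (Fin n) ℝ) :
    lowRankError k A.transpose = lowRankError k A :=
  le_antisymm (lowRankError_transpose_le k A) (lowRankError_transpose_le k A.transpose)

lemma lowRankError_le_of_submatrix_eq_fromBlocks {τ σ υ : Type*} [Fintype τ] [Fintype σ]
    {A : Matrix (Fin m) (Fin n) ℝ} {R : κ ⊕ τ ≃ Fin m} {C : υ ⊕ σ ≃ Fin n}
    (hk : Fintype.card κ ≤ k) {Z : Matrix κ υ ℝ} {X : Matrix κ σ ℝ} {Y : Matrix τ σ ℝ}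
    (hA : A.submatrix R C = Matrix.fromBlocks Z X 0 Y) : lowRankError k A ≤ ‖Y‖ := by
  classical
  have : Fintype υ := Fintype.ofInjective _ (C.injective.comp Sum.inl_injective)
  have hrank : ((Matrix.fromBlocks Z X 0 0 : Matrix (κ ⊕ τ) (υ ⊕ σ) ℝ).submatrix
      R.symm C.symm).rank ≤ k := by
    rw [Matrix.rank_submatrix]
    refine (Matrix.rank_le_card_of_support_subset _ (Finset.univ.map Function.Embedding.inl)
      fun i hi => ?_).trans (by simpa using hk)
    rcases i with a | i
    · simp
    · refine absurd (funext fun j => ?_) hi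
      rcases j with j | j <;> rfl
  refine (lowRankError_le hrank).trans_eq ?_
  have hY : ‖(Matrix.fromBlocks 0 0 0 Y : Matrix (κ ⊕ τ) (υ ⊕ σ) ℝ)‖ = ‖Y‖ := by
    rw [← sq_eq_sq₀ (norm_nonneg _) (norm_nonneg _), frobenius_norm_sq_fromBlocks]
    simp
  rw [← frobenius_norm_submatrix_equiv _ R C, ← hY]
  have hA' i j : A (R i) (C j) = Matrix.fromBlocks Z X 0 Y i j := congr_fun₂ hA i j
  congr 1
  ext (i | i) (j | j) <;> simp [hA']

lemma IsLowRankApprox.transpose {A B : Matrix (Fin m) (Fin n) ℝ}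
    (h : IsLowRankApprox α γ k A B) : IsLowRankApprox α γ k A.transpose B.transpose := by
  refine ⟨(Matrix.rank_transpose B).trans_le h.1, ?_⟩
  rw [← Matrix.transpose_sub, Matrix.frobenius_norm_transpose, lowRankError_transpose]
  exact h.2

lemma IsLowRankApprox.mono {γ' : ℝ} (hγ : γ ≤ γ') {A B : Matrix (Fin m) (Fin n) ℝ}
    (h : IsLowRankApprox α γ k A B) : IsLowRankApprox α γ' k A B :=
  ⟨h.1, h.2.trans (by gcongr)⟩

namespace BlockDecodable

variable {β F : Type*} [Fintype F] {ρ : ℝ} {q U : ℕ} {φ : β × F ↪ Fin m × Fin n}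
  {G : β → Matrix (Fin m) (Fin n) ℤ}

lemma anti {γ' : ℝ} (hγ : γ' ≤ γ) (h : BlockDecodable ρ α γ k q U φ G) :
    BlockDecodable ρ α γ' k q U φ G :=
  fun b v hv B hB => h b v hv B (hB.mono hγ)

lemma transpose (h : BlockDecodable ρ α γ k q U φ G) :
    BlockDecodable ρ α γ k q U (φ.trans (Equiv.prodComm (Fin m) (Fin n)).toEmbedding)
      fun b => (G b).transpose := by
  intro b v hv B hB
  have hB' := hB.transpose
  rw [← entryMatrix_transpose, ← Matrix.transpose_add, Matrix.transpose_map,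
    Matrix.transpose_transpose] at hB'
  exact h b v hv B.transpose hB'

end BlockDecodable

end Frobenius

/-! ### Matrices of low rank with a dominant minor -/

section DominantMinor

variable {κ τ σ : Type*} [Fintype κ] [DecidableEq κ]

lemma eq_mul_invOf_mul_of_rank_fromBlocks_le {K : Type*} [Field K] [Fintype σ]
    {A : Matrix κ κ K} [Invertible A] {B : Matrix κ σ K} {C : Matrix τ κ K} {D : Matrix τ σ K}
    (h : (Matrix.fromBlocks A B C D).rank ≤ Fintype.card κ) : D = C * ⅟A * B := by
  ext i j
  have hdet : (Matrix.fromBlocks A (B.submatrix id fun _ : Unit => j)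
      (C.submatrix (fun _ : Unit => i) id) (D.submatrix (fun _ => i) fun _ => j)).det = 0 := by
    by_contra hne
    have hfull := Matrix.rank_of_isUnit _ ((Matrix.isUnit_iff_isUnit_det _).2 (Ne.isUnit hne))
    have hsub := (Matrix.fromBlocks A B C D).rank_submatrix_le
      (Sum.map id fun _ : Unit => i) (Sum.map id fun _ : Unit => j)
    rw [show (Matrix.fromBlocks A B C D).submatrix (Sum.map id fun _ => i) (Sum.map id fun _ => j)
      = Matrix.fromBlocks A (B.submatrix id fun _ : Unit => j)
        (C.submatrix (fun _ : Unit => i) id) (D.submatrix (fun _ => i) fun _ => j) by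
        ext (_ | _) (_ | _) <;> rfl, hfull, Fintype.card_sum, Fintype.card_unit] at hsub
    omega
  rw [Matrix.det_fromBlocks₁₁, mul_eq_zero,
    or_iff_right (Matrix.isUnit_det_of_invertible A).ne_zero, Matrix.det_unique, Matrix.sub_apply,
    sub_eq_zero] at hdet
  simpa [Matrix.mul_apply] using hdet

variable [Fintype τ] [Fintype σ] {P T : ℝ}

lemma mul_frobenius_norm_le_norm_mul {S : Matrix κ κ ℝ}
    (hS : ‖P • (1 : Matrix κ κ ℝ) - S‖ ≤ T) (u : Matrix τ κ ℝ) : (P - T) * ‖u‖ ≤ ‖u * S‖ := by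
  have hu : P • u = u * S + u * (P • (1 : Matrix κ κ ℝ) - S) := by
    rw [← Matrix.mul_add, add_sub_cancel, Matrix.mul_smul, Matrix.mul_one]
  have hPu : P * ‖u‖ ≤ ‖u * S‖ + ‖u‖ * T :=
    calc P * ‖u‖ ≤ ‖P • u‖ := by rw [norm_smul]; gcongr; exact le_abs_self P
      _ ≤ ‖u * S‖ + ‖u * (P • (1 : Matrix κ κ ℝ) - S)‖ := hu ▸ norm_add_le _ _
      _ ≤ ‖u * S‖ + ‖u‖ * T := by
          gcongr
          exact (Matrix.frobenius_norm_mul _ _).trans (by gcongr)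
  linarith

lemma isUnit_of_frobenius_norm_smul_one_sub_le {S : Matrix κ κ ℝ} (hTP : T < P)
    (hS : ‖P • (1 : Matrix κ κ ℝ) - S‖ ≤ T) : IsUnit S := by
  have hP : 0 < P := (norm_nonneg _).trans_lt (hS.trans_lt hTP)
  have hunit : IsUnit (1 - P⁻¹ • (P • (1 : Matrix κ κ ℝ) - S)) := by
    refine isUnit_one_sub_of_norm_lt_one ?_
    rw [norm_smul, norm_inv, Real.norm_of_nonneg hP.le, inv_mul_lt_one₀ hP]
    exact hS.trans_lt hTP
  rw [smul_sub, inv_smul_smul₀ hP.ne', sub_sub_cancel] at hunit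
  rwa [← Units.smul_mk0 (inv_ne_zero hP.ne'), isUnit_smul_iff] at hunit

lemma mul_frobenius_norm_le_of_rank_fromBlocks_le {S : Matrix κ κ ℝ} {X : Matrix κ σ ℝ}
    {W : Matrix τ κ ℝ} {Y : Matrix τ σ ℝ} (hTP : T < P) (hS : ‖P • (1 : Matrix κ κ ℝ) - S‖ ≤ T)
    (h : (Matrix.fromBlocks S X W Y).rank ≤ Fintype.card κ) : (P - T) * ‖Y‖ ≤ ‖W‖ * ‖X‖ := by
  obtain ⟨hinv⟩ := (isUnit_of_frobenius_norm_smul_one_sub_le hTP hS).nonempty_invertible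
  calc (P - T) * ‖Y‖ = (P - T) * ‖W * ⅟S * X‖ := by
        rw [eq_mul_invOf_mul_of_rank_fromBlocks_le h]
    _ ≤ (P - T) * ‖W * ⅟S‖ * ‖X‖ := by
        rw [mul_assoc]
        exact mul_le_mul_of_nonneg_left (Matrix.frobenius_norm_mul _ _) (sub_pos.2 hTP).le
    _ ≤ ‖W * ⅟S * S‖ * ‖X‖ := by
        gcongr
        exact mul_frobenius_norm_le_norm_mul hS _
    _ = ‖W‖ * ‖X‖ := by rw [Matrix.mul_assoc, invOf_mul_self, Matrix.mul_one]

/-- The block `P • 1` forces the approximation `B` to spend its rank on the first rows. It is then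
almost zero below `X`, where it loses `‖Y‖ ^ 2`, so that only little error is left for `X`. -/
lemma norm_sq_sub_toBlocks₁₂_le_of_rank_le {X : Matrix κ σ ℝ} {Y : Matrix τ σ ℝ}
    {B : Matrix (κ ⊕ τ) (κ ⊕ σ) ℝ} (hB : B.rank ≤ Fintype.card κ)
    (hTP : T < P) (hAB : ‖Matrix.fromBlocks (P • 1) X 0 Y - B‖ ≤ T) :
    ‖X - B.toBlocks₁₂‖ ^ 2 ≤ T ^ 2 - ‖Y‖ ^ 2 + 2 * (T * (‖X‖ + T) / (P - T)) * ‖Y‖ := by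
  obtain ⟨S, X', W, Y', rfl⟩ : ∃ S X' W Y', B = Matrix.fromBlocks S X' W Y' :=
    ⟨_, _, _, _, B.fromBlocks_toBlocks.symm⟩
  have hT : 0 ≤ T := (norm_nonneg _).trans hAB
  have hdiff : Matrix.fromBlocks (P • 1) X 0 Y - Matrix.fromBlocks S X' W Y'
      = Matrix.fromBlocks (P • 1 - S) (X - X') (-W) (Y - Y') := by
    ext (i | i) (j | j) <;> simp
  rw [hdiff] at hAB
  have hsplit := pow_le_pow_left₀ (norm_nonneg _) hAB 2
  rw [frobenius_norm_sq_fromBlocks, norm_neg] at hsplit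
  obtain ⟨hS, hXX', hW⟩ : ‖P • 1 - S‖ ≤ T ∧ ‖X - X'‖ ≤ T ∧ ‖W‖ ≤ T := by
    refine ⟨le_of_sq_le_sq ?_ hT, le_of_sq_le_sq ?_ hT, le_of_sq_le_sq ?_ hT⟩ <;>
      linarith [sq_nonneg (‖P • 1 - S‖), sq_nonneg (‖X - X'‖), sq_nonneg (‖W‖),
        sq_nonneg (‖Y - Y'‖)]
  have hX' : ‖X'‖ ≤ ‖X‖ + T := by
    linarith [norm_le_norm_add_norm_sub' X' X, norm_sub_rev X X']
  have hY' : ‖Y'‖ ≤ T * (‖X‖ + T) / (P - T) := by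
    rw [le_div_iff₀' (sub_pos.2 hTP)]
    exact (mul_frobenius_norm_le_of_rank_fromBlocks_le hTP hS hB).trans (by gcongr)
  have hlost : ‖Y‖ ^ 2 - 2 * (T * (‖X‖ + T) / (P - T)) * ‖Y‖ ≤ ‖Y - Y'‖ ^ 2 := by
    have habs : (‖Y‖ - ‖Y'‖) ^ 2 ≤ ‖Y - Y'‖ ^ 2 :=
      sq_le_sq.2 ((abs_norm_sub_norm_le Y Y').trans_eq (abs_norm _).symm)
    nlinarith [norm_nonneg Y, sq_nonneg (‖Y'‖)]
  rw [Matrix.toBlocks_fromBlocks₁₂]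
  linarith [sq_nonneg (‖P • 1 - S‖), sq_nonneg (‖W‖)]

lemma norm_sq_sub_submatrix_le_of_isLowRankApprox {m n k : ℕ} {α γ : ℝ}
    (hk : Fintype.card κ = k) (hα : 0 ≤ α) {R : κ ⊕ τ ≃ Fin m} {C : κ ⊕ σ ≃ Fin n}
    {X : Matrix κ σ ℝ} {Y : Matrix τ σ ℝ} {A B : Matrix (Fin m) (Fin n) ℝ}
    (hA : A.submatrix R C = Matrix.fromBlocks (P • 1) X 0 Y) (hB : IsLowRankApprox α γ k A B)
    (hT : (1 + α) * ‖Y‖ + γ ≤ T) (hTP : T < P) :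
    ‖X - B.submatrix (R ∘ Sum.inl) (C ∘ Sum.inr)‖ ^ 2
      ≤ T ^ 2 - ‖Y‖ ^ 2 + 2 * (T * (‖X‖ + T) / (P - T)) * ‖Y‖ := by
  refine norm_sq_sub_toBlocks₁₂_le_of_rank_le (B := B.submatrix R C) ?_ hTP ?_
  · exact (B.rank_submatrix_le _ _).trans (hB.1.trans hk.ge)
  · rw [← hA]
    calc ‖A.submatrix R C - B.submatrix R C‖ = ‖A - B‖ :=
          frobenius_norm_submatrix_equiv (A - B) R C
      _ ≤ (1 + α) * lowRankError k A + γ := hB.2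
      _ ≤ (1 + α) * ‖Y‖ + γ := by
          gcongr
          exact lowRankError_le_of_submatrix_eq_fromBlocks hk.le hA
      _ ≤ T := hT

end DominantMinor

/-! ### Decodable blocks -/

lemma one_sub_mul_card_le_card_filter_abs_lt {F : Type*} [Fintype F] {y : F → ℝ} {ε t : ℝ}
    (ht : 0 < t) (h : ∑ f, y f ^ 2 ≤ ε * t ^ 2 * Fintype.card F) :
    (1 - ε) * Fintype.card F ≤ (Finset.univ.filter fun f => |y f| < t).card := by
  have hmarkov : (Finset.univ.filter fun f => ¬ |y f| < t).card * t ^ 2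
      ≤ ε * Fintype.card F * t ^ 2 :=
    calc _ = ∑ f, if ¬ |y f| < t then t ^ 2 else 0 := by
          rw [← nsmul_eq_mul, ← Finset.sum_const, Finset.sum_filter]
      _ ≤ ∑ f, y f ^ 2 := by
          gcongr with f
          split_ifs with hf
          · exact sq_nonneg _
          · exact sq_le_sq.2 ((abs_of_pos ht).trans_le (not_lt.1 hf))
      _ ≤ _ := h.trans_eq (by ring)
  have hfar := le_of_mul_le_mul_right hmarkov (by positivity)
  have hcard : ((Finset.univ.filter fun f => |y f| < t).card : ℝ)
      + (Finset.univ.filter fun f => ¬ |y f| < t).card = Fintype.card F := by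
    exact_mod_cast Finset.card_filter_add_card_filter_not (s := Finset.univ) fun f => |y f| < t
  linarith

section RowBlock

variable {m n k q U : ℕ} {κ : Type*} [Fintype κ]

lemma lowRankError_eq_zero {A : Matrix (Fin m) (Fin n) ℝ} (hA : A.rank ≤ k) :
    lowRankError k A = 0 :=
  le_antisymm ((lowRankError_le hA).trans_eq (by rw [sub_self, norm_zero]))
    (Real.iInf_nonneg fun _ => norm_nonneg _)

/-- The entries of the rows `r`, as a single block. -/
def rowEntry (n : ℕ) (r : κ ↪ Fin m) : Unit × (κ × Fin n) ↪ Fin m × Fin n :=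
  (Equiv.punitProd (κ × Fin n)).toEmbedding.trans (r.prodMap (Function.Embedding.refl (Fin n)))

lemma rank_entryMatrix_rowEntry_le (r : κ ↪ Fin m) (w : Unit × (κ × Fin n) → ℝ) :
    (entryMatrix (rowEntry n r) w).rank ≤ Fintype.card κ := by
  refine (Matrix.rank_le_card_of_support_subset _ (Finset.univ.map r) fun i hi => ?_).trans_eq
    (by rw [Finset.card_map, Finset.card_univ])
  by_contra hr
  refine hi (funext fun j => entryMatrix_apply_of_forall_ne w fun e he => hr ?_)
  simpa using ⟨e.2.1, congrArg Prod.fst he⟩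

lemma blockDecodable_rowEntry {ρ α γ : ℝ} (hρ : ρ ≤ 1) (hκ : Fintype.card κ ≤ k)
    (hU : 4 * γ < U) (r : κ ↪ Fin m) : BlockDecodable ρ α γ k q U (rowEntry n r) 0 := by
  intro b v _ B hB
  rw [Pi.zero_apply, add_zero, entryMatrix_map _ _ Int.cast_zero] at hB
  have hdist := hB.2
  rw [lowRankError_eq_zero ((rank_entryMatrix_rowEntry_le r _).trans hκ), mul_zero,
    zero_add] at hdist
  have hall (f : κ × Fin n) :
      4 * |B (rowEntry n r (b, f)).1 (rowEntry n r (b, f)).2 - v (b, f)| < U := by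
    have h := (abs_apply_le_frobenius_norm _ (rowEntry n r (b, f)).1
      (rowEntry n r (b, f)).2).trans hdist
    rw [Matrix.sub_apply, entryMatrix_apply_self, abs_sub_comm, Function.comp_apply] at h
    linarith
  rw [Finset.filter_true_of_mem fun f _ => hall f, Finset.card_univ]
  exact mul_le_of_le_one_left (Nat.cast_nonneg _) hρ

end RowBlock

section DominantBlock

variable {m n k q U : ℕ} {ι κ σ : Type*} {r : ι × κ ↪ Fin m} {c : κ ⊕ σ ↪ Fin n}

/-- The positions in the rows `r (b, ·)` of the blocks `b` and in the columns `c (Sum.inr ·)`. -/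
def dataEntry (r : ι × κ ↪ Fin m) (c : κ ⊕ σ ↪ Fin n) : ι × (κ × σ) ↪ Fin m × Fin n :=
  (Equiv.prodAssoc ι κ σ).symm.toEmbedding.trans (r.prodMap (Function.Embedding.inr.trans c))

/-- The diagonal positions in the rows of the block `b` and in the columns `c (Sum.inl ·)`, which
contain no data. -/
def diagonalEntry (r : ι × κ ↪ Fin m) (c : κ ⊕ σ ↪ Fin n) (b : ι) : κ ↪ Fin m × Fin n where
  toFun a := (r (b, a), c (Sum.inl a))
  inj' _ _ h := Sum.inl_injective (c.injective (congrArg Prod.snd h))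

/-- The matrix that is `P` at the diagonal positions of the block `b`. -/
noncomputable def dominantBlock (r : ι × κ ↪ Fin m) (c : κ ⊕ σ ↪ Fin n) (P : ℕ) (b : ι) :
    Matrix (Fin m) (Fin n) ℤ :=
  entryMatrix (diagonalEntry r c b) fun _ => (P : ℤ)

lemma abs_dominantBlock_le (P : ℕ) (b : ι) (i : Fin m) (j : Fin n) :
    |dominantBlock r c P b i j| ≤ P :=
  forall_entryMatrix (p := fun z : ℤ => |z| ≤ P) (by simp) (by simp) i j

lemma exists_sum_equiv_of_injective {α β : Type*} {f : α → β} (hf : Function.Injective f) :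
    ∃ e : α ⊕ ↥(Set.range f)ᶜ ≃ β, ∀ a, e (Sum.inl a) = f a := by
  classical
  exact ⟨((Equiv.ofInjective f hf).sumCongr (Equiv.refl _)).trans (Equiv.Set.sumCompl _),
    fun a => rfl⟩

lemma submatrix_entryMatrix_add_entryMatrix {K : Type*} [NonAssocSemiring K] [DecidableEq κ]
    {τ υ : Type*} {b : ι} {R : κ ⊕ τ ≃ Fin m} {C : κ ⊕ υ ≃ Fin n}
    (hR : ∀ a, R (Sum.inl a) = r (b, a)) (hC : ∀ a, C (Sum.inl a) = c (Sum.inl a)) (p : K)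
    (w : ι × (κ × σ) → K) :
    (entryMatrix (dataEntry r c) w + entryMatrix (diagonalEntry r c b) fun _ => p).submatrix R C
      = Matrix.fromBlocks (p • 1)
        ((entryMatrix (dataEntry r c) w).submatrix (R ∘ Sum.inl) (C ∘ Sum.inr)) 0
        ((entryMatrix (dataEntry r c) w).submatrix (R ∘ Sum.inr) (C ∘ Sum.inr)) := by
  have hdata i a : entryMatrix (dataEntry r c) w i (c (Sum.inl a)) = 0 :=
    entryMatrix_apply_of_forall_ne w fun e he =>
      Sum.inr_ne_inl (c.injective (congrArg Prod.snd he))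
  have hcol i y : entryMatrix (diagonalEntry r c b) (fun _ => p) i (C (Sum.inr y)) = 0 :=
    entryMatrix_apply_of_forall_ne _ fun a ha =>
      Sum.inl_ne_inr (C.injective ((hC a).trans (congrArg Prod.snd ha)))
  have hrow i j : entryMatrix (diagonalEntry r c b) (fun _ => p) (R (Sum.inr i)) j = 0 :=
    entryMatrix_apply_of_forall_ne _ fun a ha =>
      Sum.inl_ne_inr (R.injective ((hR a).trans (congrArg Prod.fst ha)))
  have hdiag a a' : entryMatrix (diagonalEntry r c b) (fun _ => p) (r (b, a)) (c (Sum.inl a'))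
      = if a = a' then p else 0 := by
    split_ifs with h
    · exact h ▸ entryMatrix_apply_self (diagonalEntry r c b) _ a
    · refine entryMatrix_apply_of_forall_ne _ fun a'' ha => h ?_
      have hrow' := r.injective (congrArg Prod.fst ha)
      have hcol' := c.injective (congrArg Prod.snd ha)
      simp_all
  ext (a | i) (a' | y)
  · simp [hR, hC, hdata, hdiag, Matrix.one_apply]
  · simp [hcol]
  · simp [hC, hdata, hrow]
  · simp [hcol]

lemma two_mul_div_mul_le {L P U T x y : ℝ} (hU : 0 < U) (hUL : U ≤ L)
    (hP : 48000 * L ^ 3 ≤ P * U ^ 2) (hT₀ : 0 ≤ T) (hT : T ≤ 3 * L) (hx₀ : 0 ≤ x) (hx : x ≤ L)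
    (hy₀ : 0 ≤ y) (hy : y ≤ L) : T < P ∧ 2 * (T * (x + T) / (P - T)) * y ≤ U ^ 2 / 1000 := by
  have hL : 0 < L := hU.trans_le hUL
  have hLP : 48000 * L ≤ P := by
    refine le_of_mul_le_mul_right ?_ (pow_pos hU 2)
    calc 48000 * L * U ^ 2 ≤ 48000 * L * L ^ 2 := by gcongr
      _ = 48000 * L ^ 3 := by ring
      _ ≤ P * U ^ 2 := hP
  have hP₀ : 0 < P := by linarith
  refine ⟨by linarith, ?_⟩
  calc 2 * (T * (x + T) / (P - T)) * y ≤ 2 * (3 * L * (L + 3 * L) / (P / 2)) * L := by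
        gcongr
        linarith
    _ = 48000 * L ^ 3 / P / 1000 := by field_simp; ring
    _ ≤ P * U ^ 2 / P / 1000 := by gcongr
    _ = U ^ 2 / 1000 := by rw [mul_div_cancel_left₀ _ hP₀.ne']

lemma sq_sub_sq_le {α γ y W : ℝ} (hα₀ : 0 ≤ α) (hα₁ : α ≤ 1) (hγ : 0 ≤ γ) (hy : 0 ≤ y)
    (hαy : 960 * (α * y ^ 2) ≤ W) (hγy : 4000 * (γ * y) ≤ W) (hγγ : 4000 * γ ^ 2 ≤ W) :
    ((1 + α) * y + γ) ^ 2 - y ^ 2 ≤ W / 200 := by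
  have hαα : α * (α * y ^ 2) ≤ 1 * (α * y ^ 2) := by gcongr
  have hαγ : α * (γ * y) ≤ 1 * (γ * y) := by gcongr
  linarith [mul_nonneg hα₀ (sq_nonneg y)]

lemma dominantBlock_excess_le {α γ M q U P N f x y : ℝ} (hM : 1 ≤ M) (hq : 1 ≤ q) (hN : 1 ≤ N)
    (hU : 0 < U) (hf : 1 ≤ f) (hα₀ : 0 ≤ α) (hα : 960 * q ^ 2 * α * N ≤ 1) (hγ₀ : 0 ≤ γ)
    (hγ : 4000 * q * M * γ ≤ U) (hP : 48000 * M ^ 3 * q ^ 3 * U ≤ P) (hx₀ : 0 ≤ x)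
    (hx : x ≤ M * (q * U)) (hy₀ : 0 ≤ y) (hy : y ≤ M * (q * U))
    (hyN : y ^ 2 ≤ N * f * (q * U) ^ 2) :
    (1 + α) * y + γ < P ∧
      ((1 + α) * y + γ) ^ 2 - y ^ 2
          + 2 * (((1 + α) * y + γ) * (x + ((1 + α) * y + γ)) / (P - ((1 + α) * y + γ))) * y
        ≤ U ^ 2 * f / 160 := by
  have hMq : 1 ≤ M * q := one_le_mul_of_one_le_of_one_le hM hq
  have hUL : U ≤ M * (q * U) := by
    rw [← mul_assoc]
    exact le_mul_of_one_le_left hU.le hMq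
  have hγU : 4000 * γ ≤ U :=
    calc 4000 * γ ≤ 4000 * (M * q * γ) := by gcongr; exact le_mul_of_one_le_left hγ₀ hMq
      _ ≤ U := by linarith
  have hα₁ : α ≤ 1 :=
    calc α = 1 * 1 ^ 2 * α * 1 := by ring
      _ ≤ 960 * q ^ 2 * α * N := by gcongr; norm_num
      _ ≤ 1 := hα
  have hUf : U ^ 2 ≤ U ^ 2 * f := le_mul_of_one_le_right (by positivity) hf
  have hT : (1 + α) * y + γ ≤ 3 * (M * (q * U)) := by
    have hαy : α * y ≤ 1 * y := by gcongr
    linarith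
  obtain ⟨hTP, hcross⟩ := two_mul_div_mul_le hU hUL (P := P) (T := (1 + α) * y + γ)
    (by calc 48000 * (M * (q * U)) ^ 3 = 48000 * M ^ 3 * q ^ 3 * U * U ^ 2 := by ring
          _ ≤ P * U ^ 2 := by gcongr) (by positivity) hT hx₀ hx hy₀ hy
  have hsq := sq_sub_sq_le (W := U ^ 2 * f) hα₀ hα₁ hγ₀ hy₀
    (by calc 960 * (α * y ^ 2) ≤ 960 * (α * (N * f * (q * U) ^ 2)) := by gcongr
          _ = 960 * q ^ 2 * α * N * (U ^ 2 * f) := by ring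
          _ ≤ U ^ 2 * f := mul_le_of_le_one_left (by positivity) hα)
    (by calc 4000 * (γ * y) ≤ 4000 * (γ * (M * (q * U))) := by gcongr
          _ = 4000 * q * M * γ * U := by ring
          _ ≤ U * U := by gcongr
          _ ≤ U ^ 2 * f := by rwa [← sq])
    (by nlinarith)
  exact ⟨hTP, by linarith [sq_nonneg U]⟩

lemma sum_sq_dataEntry_le [Fintype κ] [Fintype σ] {υ : Type*} [Fintype υ] {b : ι} {R : κ → Fin m}
    {C : σ ⊕ υ → Fin n} (hR : ∀ a, R a = r (b, a)) (hC : ∀ s, C (Sum.inl s) = c (Sum.inr s))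
    (w : ι × (κ × σ) → ℝ) (B : Matrix (Fin m) (Fin n) ℝ) :
    ∑ f, (B (dataEntry r c (b, f)).1 (dataEntry r c (b, f)).2 - w (b, f)) ^ 2
      ≤ ‖(entryMatrix (dataEntry r c) w).submatrix R C - B.submatrix R C‖ ^ 2 := by
  have hsub := frobenius_norm_submatrix_le
    ((entryMatrix (dataEntry r c) w).submatrix R C - B.submatrix R C) (r := id)
    (c := (Sum.inl : σ → σ ⊕ υ)) Function.injective_id Sum.inl_injective
  refine le_trans (le_of_eq ?_) (pow_le_pow_left₀ (norm_nonneg _) hsub 2)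
  rw [frobenius_norm_sq, Fintype.sum_prod_type]
  refine Finset.sum_congr rfl fun a _ => Finset.sum_congr rfl fun s _ => ?_
  rw [sub_sq_comm, ← entryMatrix_apply_self (dataEntry r c) w (b, a, s)]
  simp [dataEntry, hR, hC]

lemma frobenius_norm_entryMatrix_le {E : Type*} (φ : E ↪ Fin m × Fin n) {w : E → ℝ} {b : ℝ}
    (hb : 0 ≤ b) (hw : ∀ e, |w e| ≤ b) : ‖entryMatrix φ w‖ ≤ ((m : ℝ) + n) * b := by
  have : Fintype E := Fintype.ofInjective φ φ.injective
  have hcard : (Fintype.card E : ℝ) ≤ m * n := by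
    exact_mod_cast (Fintype.card_le_of_embedding φ).trans_eq (by simp)
  refine le_of_sq_le_sq ?_ (by positivity)
  calc ‖entryMatrix φ w‖ ^ 2 ≤ Fintype.card E * b ^ 2 := frobenius_norm_sq_entryMatrix_le φ hw
    _ ≤ ((m : ℝ) + n) ^ 2 * b ^ 2 := by
        gcongr
        nlinarith [(m.cast_nonneg : (0 : ℝ) ≤ m), (n.cast_nonneg : (0 : ℝ) ≤ n)]
    _ = (((m : ℝ) + n) * b) ^ 2 := (mul_pow _ _ 2).symm

lemma sum_sq_sub_le_of_isLowRankApprox [Fintype ι] [Fintype κ] [Fintype σ] {α γ : ℝ} {P : ℕ}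
    (hk : Fintype.card κ = k) (hα₀ : 0 ≤ α) (hα : 960 * (q : ℝ) ^ 2 * α * Fintype.card ι ≤ 1)
    (hγ₀ : 0 ≤ γ) (hq : 0 < q) (hU : 0 < U) (hγ : 4000 * (q : ℝ) * ((m : ℝ) + n) * γ ≤ U)
    (hP : 48000 * ((m : ℝ) + n) ^ 3 * (q : ℝ) ^ 3 * U ≤ P) [Nonempty (κ × σ)] (b : ι)
    {w : ι × (κ × σ) → ℝ} (hw : ∀ e, |w e| ≤ q * U) {B : Matrix (Fin m) (Fin n) ℝ}
    (hB : IsLowRankApprox α γ k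
      (entryMatrix (dataEntry r c) w + entryMatrix (diagonalEntry r c b) fun _ => (P : ℝ)) B) :
    ∑ f, (B (dataEntry r c (b, f)).1 (dataEntry r c (b, f)).2 - w (b, f)) ^ 2
      ≤ (U : ℝ) ^ 2 * Fintype.card (κ × σ) / 160 := by
  classical
  obtain ⟨R, hR⟩ := exists_sum_equiv_of_injective (r.injective.comp (Prod.mk_right_injective b))
  obtain ⟨C', hC'⟩ := exists_sum_equiv_of_injective c.injective
  set C := (Equiv.sumAssoc κ σ _).symm.trans C'
  have hpivot a : C (Sum.inl a) = c (Sum.inl a) := hC' (Sum.inl a)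
  have hdata s : C (Sum.inr (Sum.inl s)) = c (Sum.inr s) := hC' (Sum.inr s)
  have hblocks := submatrix_entryMatrix_add_entryMatrix hR hpivot (P : ℝ) w
  set V := entryMatrix (dataEntry r c) w
  have hVM : ‖V‖ ≤ ((m : ℝ) + n) * (q * U) := frobenius_norm_entryMatrix_le _ (by positivity) hw
  have hX : ‖V.submatrix (R ∘ Sum.inl) (C ∘ Sum.inr)‖ ≤ ‖V‖ := frobenius_norm_submatrix_le V
    (R.injective.comp Sum.inl_injective) (C.injective.comp Sum.inr_injective)
  have hY : ‖V.submatrix (R ∘ Sum.inr) (C ∘ Sum.inr)‖ ≤ ‖V‖ := frobenius_norm_submatrix_le V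
    (R.injective.comp Sum.inr_injective) (C.injective.comp Sum.inr_injective)
  have hYN : ‖V.submatrix (R ∘ Sum.inr) (C ∘ Sum.inr)‖ ^ 2
      ≤ Fintype.card ι * Fintype.card (κ × σ) * ((q : ℝ) * U) ^ 2 := by
    refine (pow_le_pow_left₀ (norm_nonneg _) hY 2).trans ?_
    exact_mod_cast Fintype.card_prod ι (κ × σ) ▸ frobenius_norm_sq_entryMatrix_le _ hw
  have hq₁ : (1 : ℝ) ≤ q := by exact_mod_cast hq
  have hι : (1 : ℝ) ≤ Fintype.card ι := by exact_mod_cast Fintype.card_pos_iff.2 ⟨b⟩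
  have hM : (1 : ℝ) ≤ (m : ℝ) + n := by
    obtain ⟨a, _⟩ := ‹Nonempty (κ × σ)›
    exact_mod_cast (Fin.pos (r (b, a))).trans_le (Nat.le_add_right m n)
  obtain ⟨hTP, hexcess⟩ := dominantBlock_excess_le hM hq₁ hι (by exact_mod_cast hU)
    (by exact_mod_cast Fintype.card_pos (α := κ × σ)) hα₀ hα hγ₀ hγ hP (norm_nonneg _)
    (hX.trans hVM) (norm_nonneg _) (hY.trans hVM) hYN
  exact (sum_sq_dataEntry_le hR hdata w B).trans
    ((norm_sq_sub_submatrix_le_of_isLowRankApprox hk hα₀ hblocks hB le_rfl hTP).trans hexcess)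

lemma blockDecodable_dominantBlock [Fintype ι] [Fintype κ] [Fintype σ] {α γ : ℝ} {P : ℕ}
    (hk : Fintype.card κ = k) (hα₀ : 0 ≤ α) (hα : 960 * (q : ℝ) ^ 2 * α * Fintype.card ι ≤ 1)
    (hγ₀ : 0 ≤ γ) (hq : 0 < q) (hU : 0 < U) (hγ : 4000 * (q : ℝ) * ((m : ℝ) + n) * γ ≤ U)
    (hP : 48000 * ((m : ℝ) + n) ^ 3 * (q : ℝ) ^ 3 * U ≤ P) :
    BlockDecodable (9 / 10) α γ k q U (dataEntry r c) (dominantBlock r c P) := by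
  intro b v hv B hB
  rcases isEmpty_or_nonempty (κ × σ) with hF | hF
  · simp
  have hw e : |((v e : ℤ) : ℝ)| ≤ q * U := by
    rw [abs_of_nonneg (by exact_mod_cast (hv e).1)]
    exact_mod_cast (hv e).2
  rw [dominantBlock, Matrix.map_add _ Int.cast_add, entryMatrix_map _ _ Int.cast_zero,
    entryMatrix_map _ _ Int.cast_zero] at hB
  have hsum := sum_sq_sub_le_of_isLowRankApprox hk hα₀ hα hγ₀ hq hU hγ hP b hw hB
  have hU' : (0 : ℝ) < U := by exact_mod_cast hU
  have hcount := one_sub_mul_card_le_card_filter_abs_lt (ε := 1 / 10) (t := U / 4)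
    (by linarith [hU']) (hsum.trans_eq (by ring))
  simpa only [lt_div_iff₀' (zero_lt_four' ℝ), show (1 : ℝ) - 1 / 10 = 9 / 10 by norm_num]
    using hcount

end DominantBlock

/-! ### Choice of the parameters -/

section Parameters

variable {m n k q D D' P : ℕ} {α γ : ℝ}

/-- At least `Q` data entries of an `m × n` matrix, arranged in blocks that are decodable at every
scale `U` between `D` and `D'`, with helper matrices whose entries are at most `P`. -/
def HasDecodableBlocks (m n k q D D' P : ℕ) (α γ Q : ℝ) : Prop :=
  ∃ (ι F : Type) (_ : Fintype ι) (_ : Fintype F) (φ : ι × F ↪ Fin m × Fin n)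
    (G : ι → Matrix (Fin m) (Fin n) ℤ), (∀ b i j, |G b i j| ≤ P) ∧
    (∀ U, D ≤ U → U ≤ D' → BlockDecodable (9 / 10) α γ k q U φ G) ∧
    Q ≤ Fintype.card ι * Fintype.card F

namespace HasDecodableBlocks

variable {Q : ℝ}

lemma transpose (h : HasDecodableBlocks m n k q D D' P α γ Q) :
    HasDecodableBlocks n m k q D D' P α γ Q :=
  let ⟨ι, F, hι, hF, _, _, hG, hdec, hcard⟩ := h
  ⟨ι, F, hι, hF, _, _, fun b i j => hG b j i, fun U hU hU' => (hdec U hU hU').transpose, hcard⟩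

lemma le_of_solvesLRA {S ℓ J : ℕ} {γ' : ℝ} {Ω : Type*} [MeasurableSpace Ω]
    {μ : MeasureTheory.Measure Ω} [MeasureTheory.IsProbabilityMeasure μ]
    {alg : TurnstileAlgorithm m n S ℓ Ω}
    (h : HasDecodableBlocks m n k (2 ^ 20) D (D * (8 * 2 ^ 20) ^ J) P α γ Q) (hγ : γ' ≤ γ)
    (hJ₀ : 0 < J) (hDJ : D * (8 * 2 ^ 20) ^ J ≤ 2 ^ ℓ) (hP : 4 * P < 2 ^ ℓ) (hℓ : ℓ ≤ 92 * J)
    (halg : SolvesLRA μ alg α (5 / 6) γ' k) : Q ≤ 46 * S := by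
  obtain ⟨ι, F, _, _, φ, G, hG, hdec, hcard⟩ := h
  set N := Fintype.card ι * Fintype.card F with hN
  have hentropy := rpow_le_of_solvesLRA (q := 2 ^ 20) (J := J) (D := D) (by norm_num)
    (fun j hj => (hdec _ (Nat.le_mul_of_pos_right D (by positivity))
      (by gcongr; norm_num)).anti hγ) hDJ
    (fun b i j => by
      have hPℓ : (4 : ℤ) * P < 2 ^ ℓ := by exact_mod_cast hP
      linarith [hG b i j, hPℓ]) halg
  -- With 20 bits per digit, the exponent is `(1 - 5 / 6) * (9 / 10) * 20 = 3` bits per digit.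
  have hbits : 3 * (N * J) ≤ S * ℓ + N * J := by
    refine (pow_le_pow_iff_right₀ (one_lt_two (α := ℝ))).1 ?_
    rw [pow_add]
    refine le_of_eq_of_le ?_ hentropy
    rw [Nat.cast_pow, ← Real.rpow_natCast_mul (by norm_num), ← Real.rpow_natCast]
    congr 1
    push_cast [hN]
    ring
  have hNS : N ≤ 46 * S := by
    refine Nat.le_of_mul_le_mul_right ?_ hJ₀
    have hSℓ : S * ℓ ≤ S * (92 * J) := by gcongr
    linarith
  refine hcard.trans ?_
  exact_mod_cast hNS

end HasDecodableBlocks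

lemma hasDecodableBlocks_of_one_le (hmn : m ≤ n) (hq : 0 < q) (hα₀ : 0 < α)
    (hα : 1 ≤ 960 * (q : ℝ) ^ 2 * α) (hkm : (k : ℝ) ≤ 10 * α * m) (hγ : 4 * γ < D) :
    HasDecodableBlocks m n k q D D' P α γ (((m : ℝ) + n) * k / α / (7680 * q ^ 2)) := by
  have hcount : ((m : ℝ) + n) * k / α / (7680 * q ^ 2) ≤ (min k m : ℕ) * n := by
    have hq₁ : (1 : ℝ) ≤ q := by exact_mod_cast hq
    have hmn' : (m : ℝ) + n ≤ 2 * n := by exact_mod_cast by omega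
    rw [div_div, div_le_iff₀ (by positivity)]
    rcases le_total k m with hk | hk
    · rw [min_eq_left hk]
      calc ((m : ℝ) + n) * k ≤ 2 * n * k * 1 := by rw [mul_one]; gcongr
        _ ≤ 2 * n * k * (960 * q ^ 2 * α) := by gcongr
        _ ≤ k * n * (α * (7680 * q ^ 2)) := by
            linarith [show 0 ≤ (k : ℝ) * n * α * q ^ 2 by positivity]
    · rw [min_eq_right hk]
      calc ((m : ℝ) + n) * k ≤ 2 * n * (10 * α * m) := by gcongr
        _ ≤ m * n * (α * (7680 * 1 ^ 2)) := by
            linarith [show 0 ≤ (m : ℝ) * n * α by positivity]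
        _ ≤ m * n * (α * (7680 * q ^ 2)) := by gcongr
  refine ⟨Unit, Fin (min k m) × Fin n, inferInstance, inferInstance,
    rowEntry n (Fin.castLEEmb (min_le_right k m)), 0, by simp,
    fun U hU _ => blockDecodable_rowEntry (by norm_num) (by simp)
      (hγ.trans_le (by exact_mod_cast hU)) _, hcount.trans_eq (by simp)⟩

lemma exists_nat_mul_le_one {t : ℝ} (ht : 0 < t) (ht₁ : t ≤ 1) :
    ∃ N : ℕ, t * N ≤ 1 ∧ 1 ≤ 2 * (t * N) := by
  refine ⟨⌊1 / t⌋₊, (le_div_iff₀' ht).1 (Nat.floor_le (by positivity)), ?_⟩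
  have hlt := (div_lt_iff₀' ht).1 (Nat.lt_floor_add_one (1 / t))
  have hone : (1 : ℝ) ≤ ⌊1 / t⌋₊ := by
    exact_mod_cast (Nat.one_le_floor_iff _).2 (by rwa [one_le_div ht])
  linarith [mul_le_mul_of_nonneg_left hone ht.le]

lemma hasDecodableBlocks_of_le_one (hmn : m ≤ n) (hq : 0 < q) (hα₀ : 0 < α)
    (hα : 960 * (q : ℝ) ^ 2 * α ≤ 1) (hkm : (k : ℝ) ≤ 10 * α * m) (hD : 0 < D) (hγ₀ : 0 ≤ γ)
    (hγ : 4000 * (q : ℝ) * ((m : ℝ) + n) * γ ≤ D)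
    (hP : 48000 * ((m : ℝ) + n) ^ 3 * (q : ℝ) ^ 3 * D' ≤ P) :
    HasDecodableBlocks m n k q D D' P α γ (((m : ℝ) + n) * k / α / (7680 * q ^ 2)) := by
  have hq₁ : (1 : ℝ) ≤ q := by exact_mod_cast hq
  obtain ⟨N, hNα, hαN⟩ := exists_nat_mul_le_one (by positivity) hα
  have hαq : 960 * 1 ^ 2 * α ≤ 960 * q ^ 2 * α := by gcongr
  have hNk : N * k ≤ m := by
    have h : (N : ℝ) * k ≤ m :=
      calc (N : ℝ) * k ≤ N * (10 * α * m) := by gcongr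
        _ = 10 * α * N * m := by ring
        _ ≤ 1 * m := by
            gcongr
            linarith [mul_le_mul_of_nonneg_right hαq N.cast_nonneg, show 0 ≤ α * N by positivity]
        _ = m := one_mul _
    exact_mod_cast h
  have hkn : 2 * k ≤ n := by
    have h : (2 : ℝ) * k ≤ m :=
      calc (2 : ℝ) * k ≤ 20 * α * m := by linarith
        _ ≤ 1 * m := by gcongr; linarith
        _ = m := one_mul _
    exact le_trans (by exact_mod_cast h) hmn
  have hcount : ((m : ℝ) + n) * k / α / (7680 * q ^ 2) ≤ N * (k * (n - k : ℕ)) := by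
    have hmn' : (m : ℝ) + n ≤ 4 * (n - k : ℕ) := by exact_mod_cast by omega
    rw [div_div, div_le_iff₀ (by positivity)]
    calc ((m : ℝ) + n) * k ≤ 4 * (n - k : ℕ) * k * 1 := by rw [mul_one]; gcongr
      _ ≤ 4 * (n - k : ℕ) * k * (2 * (960 * q ^ 2 * α * N)) := by gcongr
      _ = N * (k * (n - k : ℕ)) * (α * (7680 * q ^ 2)) := by ring
  obtain ⟨r⟩ : Nonempty (Fin N × Fin k ↪ Fin m) :=
    Function.Embedding.nonempty_of_card_le (by simpa using hNk)
  obtain ⟨c⟩ : Nonempty (Fin k ⊕ Fin (n - k) ↪ Fin n) :=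
    Function.Embedding.nonempty_of_card_le (by simp; omega)
  exact ⟨Fin N, Fin k × Fin (n - k), inferInstance, inferInstance, dataEntry r c,
    dominantBlock r c P, abs_dominantBlock_le P, fun U hU hU' =>
      blockDecodable_dominantBlock (by simp) hα₀.le (by simpa using hNα) hγ₀ hq (hD.trans_le hU)
        (hγ.trans (by exact_mod_cast hU)) (le_trans (by gcongr) hP), hcount.trans_eq (by simp)⟩

lemma hasDecodableBlocks (hα : 0 < α) (hmn : 1 ≤ m + n)
    (hk : (k : ℝ) / (20 * α) ≤ (min m n : ℕ) / 2) (hq : 0 < q) (hD : 0 < D) (hγ₀ : 0 ≤ γ)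
    (hγ : 4000 * (q : ℝ) * ((m : ℝ) + n) * γ ≤ D)
    (hP : 48000 * ((m : ℝ) + n) ^ 3 * (q : ℝ) ^ 3 * D' ≤ P) :
    HasDecodableBlocks m n k q D D' P α γ (((m : ℝ) + n) * k / α / (7680 * q ^ 2)) := by
  wlog hle : m ≤ n generalizing m n
  · rw [add_comm (m : ℝ)] at hγ hP ⊢
    exact (this (by omega) (by rwa [min_comm]) hγ hP (le_of_not_ge hle)).transpose
  rw [min_eq_left hle, div_le_iff₀ (by positivity)] at hk
  have hkm : (k : ℝ) ≤ 10 * α * m := hk.trans_eq (by ring)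
  rcases le_total (960 * (q : ℝ) ^ 2 * α) 1 with h | h
  · exact hasDecodableBlocks_of_le_one hle hq hα h hkm hD hγ₀ hγ hP
  · refine hasDecodableBlocks_of_one_le hle hq hα h hkm ?_
    have hqM : (1 : ℝ) ≤ q * ((m : ℝ) + n) := by exact_mod_cast Nat.mul_pos hq hmn
    have hD' : (0 : ℝ) < D := by exact_mod_cast hD
    linarith [mul_le_mul_of_nonneg_right hqM hγ₀]

lemma pow_le_two_pow_of_mul_logb_le {a M ℓ : ℕ} (hM : 0 < M) (h : a * Real.logb 2 M ≤ ℓ) :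
    M ^ a ≤ 2 ^ ℓ := by
  rw [← Real.logb_pow, Real.logb_le_iff_le_rpow one_lt_two (by positivity),
    Real.rpow_natCast] at h
  exact_mod_cast h

lemma exists_forall_mul_pow_mul_pow_lt_two_pow (a d : ℕ) {b : ℕ} (hb : 0 < b) :
    ∃ K : ℕ, 0 < K ∧ ∀ M ℓ : ℕ, 2 ≤ M → K * Real.logb 2 M ≤ ℓ →
      ∃ J, 0 < J ∧ a * M ^ d * (2 ^ b) ^ J < 2 ^ ℓ ∧ ℓ ≤ 4 * b * J := by
  refine ⟨2 * (a + d) + 2 * b, by omega, fun M ℓ hM hℓ => ?_⟩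
  have hpow := pow_le_two_pow_of_mul_logb_le (by omega) hℓ
  have hbℓ : 2 * b ≤ ℓ := by
    refine (Nat.pow_le_pow_iff_right one_lt_two).1 ?_
    calc 2 ^ (2 * b) ≤ M ^ (2 * b) := by gcongr
      _ ≤ M ^ (2 * (a + d) + 2 * b) := by gcongr <;> omega
      _ ≤ 2 ^ ℓ := hpow
  have hJ : 0 < ℓ / (2 * b) := Nat.div_pos hbℓ (by omega)
  refine ⟨ℓ / (2 * b), hJ, ?_, ?_⟩
  · refine lt_of_pow_lt_pow_left₀ 2 (by positivity) ?_
    calc (a * M ^ d * (2 ^ b) ^ (ℓ / (2 * b))) ^ 2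
        = (a * M ^ d) ^ 2 * 2 ^ (2 * b * (ℓ / (2 * b))) := by ring
      _ ≤ (a * M ^ d) ^ 2 * 2 ^ ℓ := by
          gcongr
          · norm_num
          · exact Nat.mul_div_le ℓ _
      _ < (M ^ a * M ^ d) ^ 2 * 2 ^ ℓ := by
          gcongr
          exact Nat.lt_pow_self hM
      _ = M ^ (2 * (a + d)) * 2 ^ ℓ := by ring
      _ ≤ M ^ (2 * (a + d) + 2 * b) * 2 ^ ℓ := by
          gcongr
          · omega
          · exact Nat.le_add_right _ _
      _ ≤ 2 ^ ℓ * 2 ^ ℓ := by gcongr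
      _ = (2 ^ ℓ) ^ 2 := by ring
  · have hlt := Nat.lt_mul_div_succ ℓ (show 0 < 2 * b by omega)
    calc ℓ ≤ 2 * b * (ℓ / (2 * b) + 1) := hlt.le
      _ ≤ 2 * b * (ℓ / (2 * b) + ℓ / (2 * b)) := by gcongr; omega
      _ = 4 * b * (ℓ / (2 * b)) := by ring

lemma exists_scales (q : ℕ) {b : ℕ} (hb : 0 < b) (hq : 8 * q = 2 ^ b) (C : ℝ) :
    ∃ K : ℕ, 0 < K ∧ ∀ M ℓ : ℕ, 2 ≤ M → K * Real.logb 2 M ≤ ℓ →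
      ∃ D J P : ℕ, 0 < D ∧ 0 < J ∧ 4000 * (q : ℝ) * M * (C * M) ≤ D ∧
        48000 * M ^ 3 * q ^ 3 * (D * (8 * q) ^ J) ≤ P ∧ D * (8 * q) ^ J ≤ P ∧
        4 * P < 2 ^ ℓ ∧ ℓ ≤ 4 * b * J := by
  set D₀ := ⌈4000 * q * C⌉₊ + 1
  obtain ⟨K, hK, hJ⟩ :=
    exists_forall_mul_pow_mul_pow_lt_two_pow (4 * (48000 * q ^ 3 * D₀)) 5 hb
  refine ⟨K, hK, fun M ℓ hM hℓ => ?_⟩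
  obtain ⟨J, hJ₀, hPℓ, hℓJ⟩ := hJ M ℓ hM hℓ
  refine ⟨D₀ * M ^ 2, J, 48000 * M ^ 3 * q ^ 3 * (D₀ * M ^ 2 * (8 * q) ^ J), by positivity, hJ₀,
    ?_, le_rfl, ?_, ?_, hℓJ⟩
  · have hD₀ : 4000 * q * C ≤ (D₀ : ℝ) := (Nat.le_ceil _).trans (by simp [D₀])
    calc 4000 * (q : ℝ) * M * (C * M) = 4000 * q * C * M ^ 2 := by ring
      _ ≤ D₀ * M ^ 2 := by gcongr
      _ = (D₀ * M ^ 2 : ℕ) := by push_cast; rfl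
  · have hq₀ : 0 < q := by
      have h8q : 0 < 8 * q := hq ▸ Nat.two_pow_pos b
      omega
    exact Nat.le_mul_of_pos_left _ (by positivity)
  · rw [hq]
    exact hPℓ.trans_eq' (by ring)

end Parameters

theorem mainTheorem4 :
    ∃ c : ℝ, 0 < c ∧ ∀ C : ℝ, 0 < C → ∃ K : ℝ, 0 < K ∧
      ∀ (m n k ℓ S : ℕ) (α γ : ℝ), 0 < α → γ ≤ C * ((m : ℝ) + n) →
        (k : ℝ) / (20 * α) ≤ (min m n : ℕ) / 2 →
        K * Real.logb 2 ((m : ℝ) + n) ≤ ℓ →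
        ∀ (Ω : Type*) [MeasurableSpace Ω] (μ : MeasureTheory.Measure Ω)
          [MeasureTheory.IsProbabilityMeasure μ] (alg : TurnstileAlgorithm m n S ℓ Ω),
          SolvesLRA μ alg α (5 / 6) γ k →
            c * (((m : ℝ) + n) * k / α) ≤ S := by
  refine ⟨1 / (46 * (7680 * (2 ^ 20) ^ 2)), by positivity, fun C hC => ?_⟩
  obtain ⟨K, hK, hscales⟩ := exists_scales (2 ^ 20) (b := 23) (by norm_num) (by norm_num) C
  refine ⟨K, by exact_mod_cast hK, fun m n k ℓ S α γ hα hγ hk hℓ Ω _ μ _ alg halg => ?_⟩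
  rcases k.eq_zero_or_pos with rfl | hk₀
  · simp
  have hmn : 2 ≤ m + n := by
    have hmin : (0 : ℝ) < (min m n : ℕ) := by
      linarith [show 0 < (k : ℝ) / (20 * α) by positivity]
    obtain ⟨hm, hn⟩ := lt_min_iff.1 (Nat.cast_pos.1 hmin)
    omega
  obtain ⟨D, J, P, hD, hJ, hγD, hDP, hDJ, hPℓ, hℓJ⟩ := hscales (m + n) ℓ hmn (by exact_mod_cast hℓ)
  have hblocks : HasDecodableBlocks m n k (2 ^ 20) D (D * (8 * 2 ^ 20) ^ J) P α
      (C * ((m : ℝ) + n)) _ := hasDecodableBlocks hα (by omega) hk (by positivity) hD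
    (by positivity) (by exact_mod_cast hγD) (by exact_mod_cast hDP)
  have hS := hblocks.le_of_solvesLRA hγ hJ (by omega) hPℓ hℓJ halg
  rw [div_le_iff₀ (by positivity)] at hS
  linarith
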